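/- Fix an integer $m\ge 2$, let $v_0<v_1<\cdots<v_{m-1}$ be a chain of $m$ truth values, and let Gödel implication be $v_p\Rightarrow v_q=v_{m-1}$ if $p\le q$ and $v_p\Rightarrow v_q=v_q$ if $p>q$. For $n\ge1$ a truth-table row on $n$ variables is a pair consisting of a full bracketing of $p_1\Rightarrow p_2\Rightarrow\cdots\Rightarrow p_n$ and a valuation $\nu:\{p_1,\dots,p_n\}\to\{v_0,\dots,v_{m-1}\}$. Let $g^{(k)}_n$ be the number of rows on $n$ variables whose output value is $v_k$, and let $N^{i,j}_n$ be the number of rows on $n$ variables whose bracketing has root split $\varphi\Rightarrow\psi$ with $\nu(\varphi)=v_i$ and $\nu(\psi)=v_j$ (so $N^{i,j}_1=0$). Put $G_k(x)=\sum_{n\ge1}g^{(k)}_nx^n$, $N^{i,j}(x)=\sum_{n\ge1}N^{i,j}_nx^n$ and $r=\frac1{4m}$. Then there are real constants $a_k$ and $b_k\ne0$ $(0\le k\le m-1)$ such that the following hold. 1. For each $k$, the series $G_k(x)$ converges for $|x|<r$, and as $x\to r^-$, $$G_k(x)=a_k-b_k\sqrt{1-\frac xr}+O\!\left(1-\frac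 xr\right),$$ and, as $n\to\infty$, $$[x^n]G_k(x)=g^{(k)}_n\sim\frac{b_k}{2\sqrt\pi}\,(4m)^n\,n^{-3/2}.$$ 2. For every ordered pair $(i,j)$ one has $N^{i,j}(x)=G_i(x)G_j(x)$ as formal power series. With $B_{i,j}=a_ib_j+a_jb_i$ one has $B_{i,j}\neq0$, and there is a real constant $A_{i,j}$ such that, as $x\to r^-$, $$N^{i,j}(x)=A_{i,j}-B_{i,j}\sqrt{1-\frac xr}+O\!\left(1-\frac xr\right),$$ and, as $n\to\infty$, $$N^{i,j}_n\sim\frac{B_{i,j}}{2\sqrt\pi}\,(4m)^n\,n^{-3/2}.$$ 3. All the series $N^{i,j}$ have the same dominant singularity $r$: each converges for $|x|<r$, and among the points $w$ of the circle $|w|=r$ its sum continues analytically to a neighbourhood of $w$ if and only if $w\ne r$. -/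

import Mathlib

open scoped Asymptotics

namespace Godel

/-- Full bracketings of `p₁ ⇒ p₂ ⇒ ⋯ ⇒ pₙ`, with `n` arbitrary (`n` is `Bracketing.numVars`). The
variables occur in this order from left to right, so that their names need not be recorded. -/
inductive Bracketing : Type
  | var : Bracketing
  | imp (φ ψ : Bracketing) : Bracketing

/-- The number `n` of variables of a bracketing. -/
def Bracketing.numVars : Bracketing → ℕ
  | .var => 1
  | .imp φ ψ => φ.numVars + ψ.numVars

/-- Gödel implication on the chain `v₀ < v₁ < ⋯ < v_{m-1}`, where `k : Fin m` stands for `v_k`. -/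
def godelImp {m : ℕ} (p q : Fin m) : Fin m :=
  if p ≤ q then ⟨m - 1, Nat.sub_lt q.pos Nat.one_pos⟩ else q

/-- The value of a bracketing under a valuation of its variables. The left subformula of
`imp φ ψ` contains the first `φ.numVars` variables, the right one the remaining ones. -/
def Bracketing.eval {m : ℕ} : (φ : Bracketing) → (Fin φ.numVars → Fin m) → Fin m
  | .var, ν => ν (0 : Fin 1)
  | .imp φ ψ, ν =>
      godelImp (φ.eval fun s => ν (Fin.castAdd ψ.numVars s))
        (ψ.eval fun s => ν (Fin.natAdd φ.numVars s))

/-- A truth-table row: a bracketing together with a valuation of its variables. -/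
abbrev Row (m : ℕ) : Type := Σ φ : Bracketing, (Fin φ.numVars → Fin m)

/-- The output value of a row. -/
def Row.output {m : ℕ} (ρ : Row m) : Fin m := ρ.1.eval ρ.2

/-- The root split of the row is `φ ⇒ ψ`, where `φ` takes the value `v_i` and `ψ` the value `v_j`.
This never holds for a single variable. -/
def Row.HasRootPair {m : ℕ} (i j : Fin m) : Row m → Prop
  | ⟨.var, _⟩ => False
  | ⟨.imp φ ψ, ν⟩ =>
      (φ.eval fun s => ν (Fin.castAdd ψ.numVars s)) = i ∧
        (ψ.eval fun s => ν (Fin.natAdd φ.numVars s)) = j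

/-- `g_n^{(k)}`: the number of rows on `n` variables whose output is `v_k`. -/
noncomputable def levelCount (m : ℕ) (k : Fin m) (n : ℕ) : ℕ :=
  {ρ : Row m | ρ.1.numVars = n ∧ ρ.output = k}.ncard

/-- `N_n^{i,j}`: the number of rows on `n` variables whose root split carries `(v_i, v_j)`. -/
noncomputable def pairCount (m : ℕ) (i j : Fin m) (n : ℕ) : ℕ :=
  {ρ : Row m | ρ.1.numVars = n ∧ Row.HasRootPair i j ρ}.ncard

/-- The ordinary generating function `G_k` (its constant coefficient is `0`). -/
noncomputable def levelOGF (m : ℕ) (k : Fin m) : PowerSeries ℝ :=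
  PowerSeries.mk fun n => (levelCount m k n : ℝ)

/-- The ordinary generating function `N^{i,j}`. -/
noncomputable def pairOGF (m : ℕ) (i j : Fin m) : PowerSeries ℝ :=
  PowerSeries.mk fun n => (pairCount m i j n : ℝ)

/-- The sum of a power series at a real point of convergence. -/
noncomputable def sumAt (f : PowerSeries ℝ) (x : ℝ) : ℝ :=
  ∑' n, PowerSeries.coeff n f * x ^ n

/-- The sum of a power series with real coefficients at a complex point of convergence. -/
noncomputable def sumAtComplex (f : PowerSeries ℝ) (z : ℂ) : ℂ :=
  ∑' n, ((PowerSeries.coeff n f : ℝ) : ℂ) * z ^ n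

/-- `r > 0` is the dominant singularity of `f`: the series converges for `|z| < r`, and on the circle
`|w| = r` the sum continues analytically to a neighbourhood of `w` exactly when `w ≠ r`. -/
def IsDominantSingularity (f : PowerSeries ℝ) (r : ℝ) : Prop :=
  0 < r ∧
  (∀ z : ℂ, ‖z‖ < r → Summable fun n => ((PowerSeries.coeff n f : ℝ) : ℂ) * z ^ n) ∧
  ∀ w : ℂ, ‖w‖ = r →
    ((∃ F : ℂ → ℂ, AnalyticAt ℂ F w ∧
        ∀ᶠ z in nhdsWithin w (Metric.ball (0 : ℂ) r), F z = sumAtComplex f z) ↔ w ≠ (r : ℂ))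

theorem Bracketing.numVars_pos (φ : Bracketing) : 0 < φ.numVars := by
  induction φ with
  | var => exact Nat.one_pos
  | imp φ ψ h₁ _ => exact Nat.add_pos_left h₁ _

theorem finite_bracketings (n : ℕ) : {φ : Bracketing | φ.numVars ≤ n}.Finite := by
  induction n with
  | zero =>
    refine Set.finite_empty.subset fun φ h => ?_
    have := φ.numVars_pos
    simp only [Set.mem_ofPred_eq] at h
    omega
  | succ n ih =>
    refine ((Set.finite_singleton Bracketing.var).union
      (Set.Finite.image2 Bracketing.imp ih ih)).subset fun φ h => ?_
    cases φ with
    | var => exact Or.inl rfl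
    | imp φ ψ =>
      have h₁ := φ.numVars_pos
      have h₂ := ψ.numVars_pos
      simp only [Set.mem_ofPred_eq, Bracketing.numVars] at h
      exact Or.inr ⟨φ, by simp only [Set.mem_ofPred_eq]; omega,
        ψ, by simp only [Set.mem_ofPred_eq]; omega, rfl⟩

/-- There are finitely many rows on `n` variables, so that the counts are genuine cardinalities. -/
theorem finite_rows (m n : ℕ) : {ρ : Row m | ρ.1.numVars = n}.Finite := by
  have h : {φ : Bracketing | φ.numVars = n}.Finite :=
    (finite_bracketings n).subset fun φ h => le_of_eq h
  refine (h.biUnion fun φ _ => Set.finite_range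
    fun ν : Fin φ.numVars → Fin m => (⟨φ, ν⟩ : Row m)).subset fun ρ hρ => ?_
  exact Set.mem_biUnion (x := ρ.1) hρ ⟨ρ.2, rfl⟩

end Godel

namespace Godel

open Finset Filter Topology

/-! Put T_k = G_k + ⋯ + G_{m-1}. Every pair of values has some output, so T_0 = mx + T_0², whence
T_0 = (1 - √(1 - x/r))/2 and T_0(r) = 1/2. Below the top value, an implication outputs v_k only if
its right side is v_k and its left side is larger, so G_k = x + T_{k+1} G_k. Since T_{k+1} = T_k -
G_k, this reads G_k (1 - T_k + G_k) = x (`levelOGF_quadratic`). Thus T_0 determines G_0, subtraction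
gives T_1, and so on; the last tail is G_{m-1} itself.

`SqrtSingular` bundles what this induction carries: nonnegative coefficients bounded by those of
T_0, the expansion at r, the coefficient asymptotics, and continuation at the other points of the
circle. The main step is `SqrtSingular.of_quadratic`. If g (1 - f + g) = x with 0 ≤ g ≤ f ≤ T_0
coefficientwise, then |f - 2g| ≤ f(r) ≤ 1/2 on the closed disc. Hence 1 - f + 2g, a square root of
the discriminant (1 - f)² + 4x, has positive real part there: g has no singularity that f lacks, and
the square-root term of f passes to g with an explicit nonzero factor.

The coefficient asymptotics need no contour integral. The operator x d/dx turns order n^(-3/2) into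
n^(-1/2), and convolving a sequence asymptotic to C/√n with one that is O(n^(-3/2)) multiplies C by
the sum of the latter (`tendsto_convolution`). Products G_i G_j are treated the same way. All a_k
and b_k are positive, so B_{i,j} > 0, and a nonzero square-root term excludes continuation at r
(`SqrtExpansion.not_continues`). -/

/-! ### Decomposing rows at the root. -/

/-- The row whose root split is given by the two rows `ρ` and `σ`. -/
def Row.imp {m : ℕ} (ρ σ : Row m) : Row m :=
  ⟨.imp ρ.1 σ.1, Fin.append ρ.2 σ.2⟩

theorem Row.output_imp {m : ℕ} (ρ σ : Row m) :
    (ρ.imp σ).output = godelImp ρ.output σ.output := by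
  simp [Row.output, Row.imp, Bracketing.eval]

theorem Row.hasRootPair_imp {m : ℕ} {i j : Fin m} (ρ σ : Row m) :
    (ρ.imp σ).HasRootPair i j ↔ ρ.output = i ∧ σ.output = j := by
  simp [Row.output, Row.imp, Row.HasRootPair]

theorem Row.imp_injective {m : ℕ} :
    Function.Injective fun p : Row m × Row m => p.1.imp p.2 := by
  rintro ⟨⟨φ, μ⟩, ⟨ψ, ν⟩⟩ ⟨⟨φ', μ'⟩, ⟨ψ', ν'⟩⟩ h
  obtain ⟨h, h'⟩ := Sigma.mk.inj h
  obtain ⟨rfl, rfl⟩ := Bracketing.imp.inj h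
  replace h' := eq_of_heq h'
  have h₁ : μ = μ' := by
    funext s
    simpa using congrFun h' (Fin.castAdd _ s)
  have h₂ : ν = ν' := by
    funext s
    simpa using congrFun h' (Fin.natAdd _ s)
  rw [h₁, h₂]

theorem Row.eq_imp_of_imp {m : ℕ} {φ ψ : Bracketing}
    (ν : Fin (Bracketing.imp φ ψ).numVars → Fin m) :
    (⟨.imp φ ψ, ν⟩ : Row m) = Row.imp ⟨φ, fun s => ν (Fin.castAdd ψ.numVars s)⟩
      ⟨ψ, fun s => ν (Fin.natAdd φ.numVars s)⟩ := by
  simp only [Row.imp]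
  congr 1
  exact (Fin.append_castAdd_natAdd (f := ν)).symm

theorem setOf_hasRootPair_eq {m : ℕ} (i j : Fin m) (n : ℕ) :
    {ρ : Row m | ρ.1.numVars = n ∧ Row.HasRootPair i j ρ} =
      (fun p : Row m × Row m => p.1.imp p.2) '' ⋃ q ∈ (antidiagonal n : Finset (ℕ × ℕ)),
        {ρ : Row m | ρ.1.numVars = q.1 ∧ ρ.output = i} ×ˢ
          {ρ : Row m | ρ.1.numVars = q.2 ∧ ρ.output = j} := by
  ext ρ
  constructor
  · rintro ⟨h, h'⟩
    obtain ⟨_ | ⟨φ, ψ⟩, ν⟩ := ρ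
    · exact h'.elim
    · rw [Row.eq_imp_of_imp] at h' ⊢
      rw [Row.hasRootPair_imp] at h'
      refine ⟨(_, _), ?_, rfl⟩
      simp only [Set.mem_iUnion]
      exact ⟨(φ.numVars, ψ.numVars), HasAntidiagonal.mem_antidiagonal.2 h, ⟨rfl, h'.1⟩, ⟨rfl, h'.2⟩⟩
  · rintro ⟨⟨ρ, σ⟩, h, rfl⟩
    simp only [Set.mem_iUnion] at h
    obtain ⟨⟨a, b⟩, hq, ⟨h₁, h₂⟩, ⟨h₃, h₄⟩⟩ := h
    refine ⟨?_, (Row.hasRootPair_imp _ _).2 ⟨h₂, h₄⟩⟩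
    rw [HasAntidiagonal.mem_antidiagonal] at hq
    simp only at hq h₁ h₃
    rw [← hq, ← h₁, ← h₃]
    rfl

theorem pairCount_eq_sum {m : ℕ} (i j : Fin m) (n : ℕ) :
    pairCount m i j n =
      ∑ q ∈ antidiagonal n, levelCount m i q.1 * levelCount m j q.2 := by
  have hfin (k : Fin m) (a : ℕ) : {ρ : Row m | ρ.1.numVars = a ∧ ρ.output = k}.Finite :=
    (finite_rows m a).subset fun _ h => h.1
  rw [pairCount, setOf_hasRootPair_eq, Set.ncard_image_of_injective _ Row.imp_injective]
  refine ((finite_toSet (antidiagonal n)).ncard_biUnion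
    (fun q _ => (hfin _ _).prod (hfin _ _)) ?_).trans ?_
  rotate_left
  · rw [finsum_mem_coe_finset]
    exact sum_congr rfl fun q _ => Set.ncard_prod
  · rintro ⟨a, b⟩ _ ⟨a', b'⟩ _ hne
    refine Set.disjoint_left.2 ?_
    rintro ⟨ρ, σ⟩ ⟨⟨h₁, _⟩, ⟨h₂, _⟩⟩ ⟨⟨h₃, _⟩, ⟨h₄, _⟩⟩
    simp only at h₁ h₂ h₃ h₄
    exact hne (by rw [← h₁, ← h₂, ← h₃, ← h₄])

theorem pairOGF_eq_mul {m : ℕ} (i j : Fin m) :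
    pairOGF m i j = levelOGF m i * levelOGF m j := by
  ext n
  simp [pairOGF, levelOGF, PowerSeries.coeff_mul, pairCount_eq_sum]

theorem setOf_output_eq {m : ℕ} (k : Fin m) (n : ℕ) :
    {ρ : Row m | ρ.1.numVars = n ∧ ρ.output = k} =
      {ρ : Row m | n = 1 ∧ ρ = ⟨.var, fun _ => k⟩} ∪
      ⋃ q ∈ ((univ : Finset (Fin m × Fin m)).filter fun q => godelImp q.1 q.2 = k),
        {ρ : Row m | ρ.1.numVars = n ∧ Row.HasRootPair q.1 q.2 ρ} := by
  ext ρ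
  simp only [Set.mem_union, Set.mem_iUnion]
  constructor
  · rintro ⟨h, h'⟩
    obtain ⟨_ | ⟨φ, ψ⟩, ν⟩ := ρ
    · refine Or.inl ⟨h.symm, ?_⟩
      congr 1
      funext s
      rw [← h', Subsingleton.elim (α := Fin 1) s 0]
      rfl
    · rw [Row.eq_imp_of_imp, Row.output_imp] at h'
      refine Or.inr ⟨(_, _), mem_filter.2 ⟨mem_univ _, h'⟩, h, ?_⟩
      rw [Row.eq_imp_of_imp, Row.hasRootPair_imp]
      exact ⟨rfl, rfl⟩
  · rintro (⟨rfl, rfl⟩ | ⟨⟨i, j⟩, hq, h, h'⟩)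
    · exact ⟨rfl, rfl⟩
    · obtain ⟨_ | ⟨φ, ψ⟩, ν⟩ := ρ
      · exact h'.elim
      · refine ⟨h, ?_⟩
        rw [Row.eq_imp_of_imp] at h' ⊢
        rw [Row.hasRootPair_imp] at h'
        rw [Row.output_imp, h'.1, h'.2]
        exact (mem_filter.1 hq).2

theorem levelCount_eq_sum {m : ℕ} (k : Fin m) (n : ℕ) :
    levelCount m k n = (if n = 1 then 1 else 0) +
      ∑ q : Fin m × Fin m with godelImp q.1 q.2 = k, pairCount m q.1 q.2 n := by
  have hfin (q : Fin m × Fin m) :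
      {ρ : Row m | ρ.1.numVars = n ∧ Row.HasRootPair q.1 q.2 ρ}.Finite :=
    (finite_rows m n).subset fun _ h => h.1
  rw [levelCount, setOf_output_eq, Set.ncard_union_eq ?_ ?_ ?_]
  · congr 1
    · split_ifs with h <;> simp [h]
    · refine ((finite_toSet _).ncard_biUnion (fun q _ => hfin q) ?_).trans ?_
      rotate_left
      · rw [finsum_mem_coe_finset]
        rfl
      · rintro ⟨a, b⟩ _ ⟨a', b'⟩ _ hne
        refine Set.disjoint_left.2 ?_
        rintro ⟨_ | ⟨φ, ψ⟩, ν⟩ ⟨_, h⟩ ⟨_, h'⟩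
        · exact h'.elim
        · exact hne (Prod.ext (h.1.symm.trans h'.1) (h.2.symm.trans h'.2))
  · refine Set.disjoint_left.2 ?_
    rintro ρ ⟨_, rfl⟩ h
    simp only [Set.mem_iUnion] at h
    obtain ⟨_, _, _, h⟩ := h
    exact h.elim
  · exact (Set.finite_singleton _).subset fun _ h => h.2
  · exact Set.Finite.biUnion (finite_toSet _) fun q _ => hfin q

theorem levelOGF_eq_sum {m : ℕ} (k : Fin m) :
    levelOGF m k = PowerSeries.X +
      ∑ q : Fin m × Fin m with godelImp q.1 q.2 = k, levelOGF m q.1 * levelOGF m q.2 := by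
  simp_rw [← pairOGF_eq_mul]
  ext n
  simp [levelOGF, pairOGF, levelCount_eq_sum k n, PowerSeries.coeff_X, map_sum]

/-! ### Tail series and their quadratic equations. -/

/-- The generating function of the rows whose output is at least `v_k`. -/
noncomputable def tailOGF (m k : ℕ) : PowerSeries ℝ :=
  ∑ i : Fin m with k ≤ i.val, levelOGF m i

theorem tailOGF_eq_add {m : ℕ} (k : Fin m) :
    tailOGF m k = levelOGF m k + tailOGF m (k + 1) := by
  rw [tailOGF, tailOGF, ← sum_insert (a := k) (by simp)]
  congr 1
  ext i
  simp only [mem_filter, mem_univ, true_and, mem_insert, Fin.ext_iff]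
  omega

theorem tailOGF_self (m : ℕ) : tailOGF m m = 0 := by
  rw [tailOGF]
  exact sum_eq_zero fun i hi => absurd (mem_filter.1 hi).2 (by omega)

/-- The sets of pairs with output v_k, for varying k, partition all pairs, so adding the level
equations gives the full square. -/
theorem tailOGF_zero_eq {m : ℕ} :
    tailOGF m 0 = (m : PowerSeries ℝ) * PowerSeries.X + tailOGF m 0 ^ 2 := by
  have h : tailOGF m 0 = ∑ i : Fin m, levelOGF m i := by simp [tailOGF]
  conv_lhs => rw [h]
  rw [sum_congr rfl fun k _ => levelOGF_eq_sum k, sum_add_distrib, sum_fiberwise, h, sq,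
    sum_mul_sum, ← sum_product', univ_product_univ]
  simp

/-- The first branch of `godelImp` yields only the top value. A lower v_k therefore comes from the
second branch, with right value v_k and left value above it. -/
theorem levelOGF_eq_of_lt {m : ℕ} (k : Fin m) (hk : k.val + 1 < m) :
    levelOGF m k = PowerSeries.X + tailOGF m (k + 1) * levelOGF m k := by
  conv_lhs => rw [levelOGF_eq_sum]
  rw [tailOGF, sum_mul]
  congr 1
  refine (sum_nbij' (fun i : Fin m => (i, k)) (fun q : Fin m × Fin m => q.1) ?_ ?_ ?_ ?_ ?_).symm
  · intro i hi
    have : k.val + 1 ≤ i.val := (mem_filter.1 hi).2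
    exact mem_filter.2 ⟨mem_univ _, if_neg (show ¬ i.val ≤ k.val by omega)⟩
  · rintro ⟨i, j⟩ h
    have := (mem_filter.1 h).2
    simp only [godelImp, Fin.ext_iff, Fin.le_def] at this
    simp only [mem_filter, mem_univ, true_and]
    split_ifs at this with h'
    · simp at this; omega
    · omega
  · simp
  · rintro ⟨i, j⟩ h
    have := (mem_filter.1 h).2
    simp only [godelImp, Fin.ext_iff, Fin.le_def] at this
    simp only [Prod.mk.injEq, true_and, Fin.ext_iff]
    split_ifs at this with h'
    · simp at this; omega
    · omega
  · simp

theorem coeff_levelOGF_nonneg {m : ℕ} (k : Fin m) (n : ℕ) :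
    0 ≤ PowerSeries.coeff n (levelOGF m k) := by
  simp [levelOGF]

theorem coeff_tailOGF_nonneg (m k n : ℕ) : 0 ≤ PowerSeries.coeff n (tailOGF m k) := by
  rw [tailOGF, map_sum]
  exact sum_nonneg fun i _ => coeff_levelOGF_nonneg i n

theorem constantCoeff_levelOGF {m : ℕ} (k : Fin m) :
    PowerSeries.constantCoeff (levelOGF m k) = 0 := by
  have : {ρ : Row m | ρ.1.numVars = 0 ∧ ρ.output = k} = ∅ :=
    Set.eq_empty_of_forall_notMem fun ρ h => ρ.1.numVars_pos.ne' h.1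
  rw [← PowerSeries.coeff_zero_eq_constantCoeff_apply, levelOGF, PowerSeries.coeff_mk, levelCount,
    this]
  simp

theorem constantCoeff_tailOGF (m k : ℕ) : PowerSeries.constantCoeff (tailOGF m k) = 0 := by
  rw [tailOGF, map_sum]
  exact sum_eq_zero fun i _ => constantCoeff_levelOGF i

theorem coeff_tailOGF_le {m : ℕ} (k n : ℕ) :
    PowerSeries.coeff n (tailOGF m k) ≤ PowerSeries.coeff n (tailOGF m 0) := by
  rw [tailOGF, tailOGF, map_sum, map_sum]
  exact sum_le_sum_of_subset_of_nonneg (fun i => by simp) fun i _ _ => coeff_levelOGF_nonneg i n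

/-! ### The total series: Catalan coefficients and Stirling asymptotics. -/

/-- The total generating function counts the bracketings of each length by Catalan numbers. -/
theorem coeff_tailOGF_zero (m n : ℕ) :
    PowerSeries.coeff (n + 1) (tailOGF m 0) = (m : ℝ) ^ (n + 1) * catalan n := by
  set S : PowerSeries ℝ := PowerSeries.mk fun n => (m : ℝ) ^ (n + 1) * catalan n with hS
  have h₁ : PowerSeries.X * S = (m : PowerSeries ℝ) * PowerSeries.X + (PowerSeries.X * S) ^ 2 := by
    have : S = (m : PowerSeries ℝ) + PowerSeries.X * S ^ 2 := by
      have hm : (m : PowerSeries ℝ) = PowerSeries.C (m : ℝ) := by simp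
      rw [hm]
      ext n
      rcases n with _ | n
      · simp [hS]
      · rw [map_add, PowerSeries.coeff_succ_X_mul, sq, PowerSeries.coeff_mul, PowerSeries.coeff_C,
          if_neg (by omega), zero_add]
        simp only [hS, PowerSeries.coeff_mk, catalan_succ']
        push_cast
        rw [mul_sum]
        refine sum_congr rfl fun q hq => ?_
        rw [← HasAntidiagonal.mem_antidiagonal.1 hq]
        ring
    linear_combination PowerSeries.X * this
  -- Two solutions of the same quadratic equation: their difference times 1 minus their sum
  -- vanishes. The second factor has constant term 1, so it is not zero.
  have h₂ : (tailOGF m 0 - PowerSeries.X * S) * (1 - tailOGF m 0 - PowerSeries.X * S) = 0 := by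
    linear_combination tailOGF_zero_eq (m := m) - h₁
  rcases mul_eq_zero.1 h₂ with h | h
  · rw [sub_eq_zero.1 h, PowerSeries.coeff_succ_X_mul, hS, PowerSeries.coeff_mk]
  · have := congrArg PowerSeries.constantCoeff h
    simp [constantCoeff_tailOGF] at this

/-- With s the Stirling sequence, which tends to √π, the expression equals s(2n)/s(n)². -/
theorem tendsto_centralBinom_mul_sqrt :
    Tendsto (fun n : ℕ => (n.centralBinom : ℝ) * √n / 4 ^ n) atTop (𝓝 (1 / √Real.pi)) := by
  have h := Stirling.tendsto_stirlingSeq_sqrt_pi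
  have hπ : √Real.pi ≠ 0 := by positivity
  have h₂ := (h.comp (tendsto_id.const_mul_atTop' (show 0 < 2 by norm_num))).div (h.pow 2)
    (pow_ne_zero 2 hπ)
  have h₃ : √Real.pi / √Real.pi ^ 2 = 1 / √Real.pi := by field_simp
  rw [h₃] at h₂
  refine h₂.congr' ?_
  filter_upwards [eventually_gt_atTop 0] with n hn
  have hn' : (0 : ℝ) < n := by exact_mod_cast hn
  have hc : ((2 * n).factorial : ℝ) = n.centralBinom * (n.factorial : ℝ) ^ 2 := by
    have := Nat.choose_mul_factorial_mul_factorial (show n ≤ 2 * n by omega)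
    rw [show 2 * n - n = n by omega] at this
    rw [Nat.centralBinom_eq_two_mul_choose, ← this]
    push_cast
    ring
  have hs : √(2 * (2 * (n : ℝ))) = 2 * √n := by
    rw [← mul_assoc, Real.sqrt_mul (by norm_num), show (2 : ℝ) * 2 = 2 ^ 2 by norm_num,
      Real.sqrt_sq (by norm_num)]
  simp only [Stirling.stirlingSeq, Function.comp, id, Pi.div_apply, Nat.cast_mul,
    Nat.cast_ofNat]
  rw [hc, hs, div_pow (n.factorial : ℝ), mul_pow √(2 * (n : ℝ)), Real.sq_sqrt (by positivity)]
  have hsq : √(n : ℝ) ^ 2 = n := Real.sq_sqrt hn'.le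
  have hf : (n.factorial : ℝ) ≠ 0 := by positivity
  have he : ((2 * (n : ℝ)) / Real.exp 1) ^ (2 * n) = 4 ^ n * (((n : ℝ) / Real.exp 1) ^ n) ^ 2 := by
    rw [mul_div_assoc, mul_pow, pow_mul, ← pow_mul _ n 2, mul_comm n 2]
    norm_num
  rw [he]
  have : ((n : ℝ) / Real.exp 1) ^ n ≠ 0 := by positivity
  have : √(n : ℝ) ≠ 0 := by positivity
  generalize ((n : ℝ) / Real.exp 1) ^ n = y at *
  generalize √(n : ℝ) = s at *
  rw [← hsq]
  field_simp

/-- The numerator 1/2 is the square-root coefficient of T_0. After the shift to n + 1 the powers of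
m cancel and leave `catalan n` over 4^(n+1), with (n + 1) `catalan n` the central binomial
coefficient. -/
theorem tendsto_coeff_tailOGF_zero {m : ℕ} (hm : 0 < m) :
    Tendsto (fun n : ℕ => PowerSeries.coeff n (tailOGF m 0) * (1 / (4 * m : ℝ)) ^ n * (n * √n))
      atTop (𝓝 ((1 / 2) / (2 * √Real.pi))) := by
  rw [← tendsto_add_atTop_iff_nat 1]
  have h₁ : Tendsto (fun n : ℕ => √(1 + 1 / (n : ℝ))) atTop (𝓝 1) := by
    have := (tendsto_one_div_atTop_nhds_zero_nat (𝕜 := ℝ)).const_add 1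
    simpa using this.sqrt
  have h₂ := (tendsto_centralBinom_mul_sqrt.mul h₁).div_const 4
  have h₃ : 1 / √Real.pi * 1 / 4 = 1 / 2 / (2 * √Real.pi) := by
    field_simp
    norm_num
  rw [h₃] at h₂
  refine h₂.congr' ?_
  filter_upwards [eventually_gt_atTop 0] with n hn
  have hn' : (0 : ℝ) < n := by exact_mod_cast hn
  have hm' : (m : ℝ) ≠ 0 := by exact_mod_cast hm.ne'
  have hs : √(n : ℝ) * √(1 + 1 / (n : ℝ)) = √((n : ℝ) + 1) := by
    rw [← Real.sqrt_mul hn'.le]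
    congr 1
    field_simp
  have hc : (n.centralBinom : ℝ) = (n + 1) * catalan n := by
    exact_mod_cast (succ_mul_catalan_eq_centralBinom n).symm
  have hp : (1 / (4 * m : ℝ)) ^ (n + 1) = 1 / (4 ^ n * 4 * (m : ℝ) ^ (n + 1)) := by
    rw [div_pow, mul_pow, one_pow, pow_succ 4]
  rw [coeff_tailOGF_zero, hp]
  push_cast
  rw [← hs, hc]
  field_simp

/-! ### Domination by the total series, and convolution of sequences. -/

/-- The coefficients of `f` are dominated by those of the total generating function. -/
def Dominated (m : ℕ) (f : PowerSeries ℝ) : Prop :=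
  ∀ n, |PowerSeries.coeff n f| ≤ PowerSeries.coeff n (tailOGF m 0)

theorem exists_coeff_tailOGF_zero_le {m : ℕ} (hm : 0 < m) :
    ∃ K : ℝ, ∀ n, PowerSeries.coeff n (tailOGF m 0) * (1 / (4 * m : ℝ)) ^ n * (n * √n) ≤ K := by
  obtain ⟨K, hK⟩ := (tendsto_coeff_tailOGF_zero hm).bddAbove_range
  exact ⟨K, fun n => hK ⟨n, rfl⟩⟩

theorem sum_one_div_sqrt_le (n : ℕ) :
    ∑ i ∈ range n, 1 / √((i : ℝ) + 1) ≤ 2 * √n := by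
  induction n with
  | zero => simp
  | succ n ih =>
    rw [sum_range_succ]
    have h₁ : 0 < √((n : ℝ) + 1) := by positivity
    have h₂ : √(n : ℝ) ≤ √((n : ℝ) + 1) := Real.sqrt_le_sqrt (by linarith)
    have h₃ : √((n : ℝ) + 1) ^ 2 = n + 1 := Real.sq_sqrt (by positivity)
    have h₄ : √(n : ℝ) ^ 2 = n := Real.sq_sqrt (by positivity)
    have h₅ : 1 / √((n : ℝ) + 1) ≤ 2 * (√((n : ℝ) + 1) - √n) := by
      rw [div_le_iff₀ h₁]
      nlinarith
    push_cast
    linarith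

/-- A sequence asymptotic to `C / √n` stays so, up to the factor `∑ c`, under convolution with a
sequence `c` of order `n ^ (-3/2)`. -/
theorem tendsto_convolution {u c : ℕ → ℝ} {C K : ℝ}
    (hu : Tendsto (fun n => u n * √n) atTop (𝓝 C)) (hc : ∀ n, |c n| * (n * √n) ≤ K)
    (hs : Summable c) :
    Tendsto (fun n => (∑ q ∈ antidiagonal n, u q.1 * c q.2) * √n) atTop (𝓝 (C * ∑' n, c n)) := by
  -- The shift to n + 1 makes the bound meaningful at n = 0 too.
  obtain ⟨M, hM⟩ : ∃ M, ∀ n, |u n| ≤ M * (1 / √((n : ℝ) + 1)) := by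
    have h₁ : Tendsto (fun n : ℕ => |u n| * √((n : ℝ) + 1)) atTop (𝓝 |C|) := by
      have h₂ : Tendsto (fun n : ℕ => √(1 + 1 / (n : ℝ))) atTop (𝓝 1) := by
        have := (tendsto_one_div_atTop_nhds_zero_nat (𝕜 := ℝ)).const_add 1
        simpa using this.sqrt
      have h₃ := hu.abs.mul h₂
      rw [mul_one] at h₃
      refine h₃.congr' ?_
      filter_upwards [eventually_gt_atTop 0] with n hn
      have hn' : (0 : ℝ) < n := by exact_mod_cast hn
      rw [abs_mul, abs_of_nonneg (Real.sqrt_nonneg _), mul_assoc, ← Real.sqrt_mul hn'.le]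
      congr 2
      field_simp
    obtain ⟨M, hM⟩ := h₁.bddAbove_range
    refine ⟨M, fun n => ?_⟩
    rw [mul_one_div, le_div_iff₀ (by positivity)]
    exact hM ⟨n, rfl⟩
  have hM0 : 0 ≤ M := by
    have := (abs_nonneg _).trans (hM 0)
    simpa using this
  have hK0 : 0 ≤ K := by simpa using hc 0
  -- Near half of the convolution. For 2k ≤ n the index n - k is at least n/2, so |u (n - k)| √n ≤
  -- 2M and dominated convergence applies with bound 2M |c k|.
  set f : ℕ → ℕ → ℝ := fun n k => if 2 * k ≤ n then u (n - k) * c k * √n else 0 with hf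
  have key : Tendsto (fun n => ∑' k, f n k) atTop (𝓝 (∑' k, C * c k)) := by
    refine tendsto_tsum_of_dominated_convergence (bound := fun k => 2 * M * |c k|)
      (hs.abs.mul_left _) (fun k => ?_) (Eventually.of_forall fun n k => ?_)
    · have h₂ : Tendsto (fun n : ℕ => √(((n + k : ℕ) : ℝ) / n)) atTop (𝓝 1) := by
        have h₁ := ((tendsto_const_div_atTop_nhds_zero_nat (k : ℝ)).const_add 1).sqrt
        rw [add_zero, Real.sqrt_one] at h₁
        refine h₁.congr' ?_
        filter_upwards [eventually_gt_atTop 0] with n hn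
        have hn' : (0 : ℝ) < n := by exact_mod_cast hn
        congr 1
        push_cast
        field_simp
      rw [← tendsto_add_atTop_iff_nat k]
      have h₃ := (hu.mul h₂).mul_const (c k)
      rw [mul_one] at h₃
      refine h₃.congr' ?_
      filter_upwards [eventually_gt_atTop k] with n hn
      have hn' : (0 : ℝ) < n := by exact_mod_cast (Nat.zero_le k).trans_lt hn
      have hn'' : √(n : ℝ) ≠ 0 := by positivity
      simp only [hf]
      rw [if_pos (by omega), Nat.add_sub_cancel, Real.sqrt_div (by positivity)]
      field_simp
    · simp only [hf]
      split_ifs with h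
      · rw [Real.norm_eq_abs, abs_mul, abs_mul, abs_of_nonneg (Real.sqrt_nonneg _)]
        have h₁ : √(n : ℝ) ≤ 2 * √(((n - k : ℕ) : ℝ) + 1) := by
          rw [show (2 : ℝ) = √4 by
            rw [show (4 : ℝ) = 2 ^ 2 by norm_num, Real.sqrt_sq (by norm_num)],
            ← Real.sqrt_mul (by norm_num)]
          apply Real.sqrt_le_sqrt
          have : n ≤ 4 * ((n - k) + 1) := by omega
          exact_mod_cast this
        have h₂ : |u (n - k)| * √(n : ℝ) ≤ 2 * M := by
          have h₃ : 0 < √(((n - k : ℕ) : ℝ) + 1) := by positivity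
          have := hM (n - k)
          calc _ ≤ M * (1 / √(((n - k : ℕ) : ℝ) + 1)) * (2 * √(((n - k : ℕ) : ℝ) + 1)) := by
                gcongr
            _ = 2 * M := by field_simp
        calc _ = |u (n - k)| * √(n : ℝ) * |c k| := by ring
          _ ≤ _ := by gcongr
      · simp only [norm_zero]
        positivity
  rw [tsum_mul_left] at key
  -- Far half, 2k > n: here |c k| √n ≤ 4K/n, while the values |u (n - k)| add up to O(√n), so the
  -- total is O(1/√n).
  have rest : Tendsto (fun n : ℕ => ∑ k ∈ range (n + 1) with ¬ 2 * k ≤ n, u (n - k) * c k * √n)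
      atTop (𝓝 0) := by
    have h₀ : Tendsto (fun n : ℕ => 8 * K * M / √(n : ℝ)) atTop (𝓝 0) := by
      refine Tendsto.div_atTop tendsto_const_nhds ?_
      exact Real.tendsto_sqrt_atTop.comp tendsto_natCast_atTop_atTop
    refine squeeze_zero_norm' ?_ h₀
    filter_upwards [eventually_gt_atTop 0] with n hn
    have hn' : (0 : ℝ) < n := by exact_mod_cast hn
    have hbound : ∀ k ∈ (range (n + 1)).filter fun k => ¬ 2 * k ≤ n,
        ‖u (n - k) * c k * √n‖ ≤ 4 * K * M / n * (1 / √(((n - k : ℕ) : ℝ) + 1)) := by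
      intro k hk
      have hk' : n ≤ 2 * k := by have := (mem_filter.1 hk).2; omega
      have hk2 : (n : ℝ) ≤ 2 * k := by exact_mod_cast hk'
      have h₁ : √(n : ℝ) ≤ 2 * √(k : ℝ) := by
        rw [show (2 : ℝ) = √4 by
          rw [show (4 : ℝ) = 2 ^ 2 by norm_num, Real.sqrt_sq (by norm_num)],
          ← Real.sqrt_mul (by norm_num)]
        exact Real.sqrt_le_sqrt (by linarith)
      have h₂ : |c k| * √(n : ℝ) ≤ 4 * K / n := by
        rw [le_div_iff₀ hn']
        calc _ ≤ |c k| * (2 * √(k : ℝ)) * (2 * k) := by gcongr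
          _ = 4 * (|c k| * (k * √k)) := by ring
          _ ≤ _ := by have := hc k; linarith
      rw [Real.norm_eq_abs, abs_mul, abs_mul, abs_of_nonneg (Real.sqrt_nonneg _), mul_assoc]
      calc _ ≤ (M * (1 / √(((n - k : ℕ) : ℝ) + 1))) * (4 * K / n) :=
            mul_le_mul (hM _) h₂ (by positivity) (by positivity)
        _ = _ := by ring
    calc _ ≤ ∑ k ∈ range (n + 1) with ¬ 2 * k ≤ n,
          4 * K * M / n * (1 / √(((n - k : ℕ) : ℝ) + 1)) := norm_sum_le_of_le _ hbound
      -- The far half only contains k ≥ 1, so k = n - j with j < n.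
      _ ≤ ∑ k ∈ (range n).image (n - ·), 4 * K * M / n * (1 / √(((n - k : ℕ) : ℝ) + 1)) := by
          refine sum_le_sum_of_subset_of_nonneg (fun k hk => ?_) fun _ _ _ => by positivity
          have := mem_filter.1 hk
          simp only [mem_range] at this
          exact mem_image.2 ⟨n - k, mem_range.2 (by omega), by omega⟩
      _ = ∑ k ∈ range n, 4 * K * M / n * (1 / √((k : ℝ) + 1)) := by
          rw [sum_image]
          · refine sum_congr rfl fun k hk => ?_
            have := mem_range.1 hk
            rw [show n - (n - k) = k by omega]
          · intro a ha b hb hab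
            have ha' : a < n := by simpa using ha
            have hb' : b < n := by simpa using hb
            simp only at hab
            omega
      _ ≤ 4 * K * M / n * (2 * √n) := by
          rw [← mul_sum]
          gcongr
          exact sum_one_div_sqrt_le n
      _ = 8 * K * M / √n := by
          have : √(n : ℝ) ^ 2 = n := Real.sq_sqrt hn'.le
          have h0 : √(n : ℝ) ≠ 0 := by positivity
          generalize √(n : ℝ) = s at *
          rw [← this]
          field_simp
          ring
  have := key.add rest
  rw [add_zero] at this
  refine this.congr fun n => ?_
  have h₁ : ∑' k, f n k = ∑ k ∈ range (n + 1) with 2 * k ≤ n, u (n - k) * c k * √n := by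
    rw [tsum_eq_sum (s := range (n + 1)), sum_filter]
    intro k hk
    simp only [mem_range] at hk
    simp only [hf]
    rw [if_neg (by omega)]
  rw [h₁, sum_filter_add_sum_filter_not, ← Nat.sum_antidiagonal_swap]
  simp only [Prod.fst_swap, Prod.snd_swap]
  rw [Nat.sum_antidiagonal_eq_sum_range_succ (fun i j => u j * c i), sum_mul]

theorem summable_of_abs_mul_le {c : ℕ → ℝ} {K : ℝ} (hc : ∀ n, |c n| * (n * √n) ≤ K) :
    Summable fun n => |c n| := by
  have h : Summable fun n : ℕ => K * (1 / (n : ℝ) ^ (3 / 2 : ℝ)) :=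
    (Real.summable_one_div_nat_rpow.2 (by norm_num)).mul_left _
  refine Summable.of_norm_bounded_eventually_nat h ?_
  filter_upwards [eventually_gt_atTop 0] with n hn
  have hn' : (0 : ℝ) < n := by exact_mod_cast hn
  have h₁ : (n : ℝ) ^ (3 / 2 : ℝ) = n * √n := by
    rw [show (3 / 2 : ℝ) = 1 + 1 / 2 by norm_num, Real.rpow_add hn', Real.rpow_one,
      Real.sqrt_eq_rpow]
  rw [Real.norm_eq_abs, abs_abs, h₁, mul_one_div, le_div_iff₀ (by positivity)]
  exact hc n

/-! ### Evaluation on the closed disc. -/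

/-- The power series `f` converges absolutely on the closed disc of radius `r`. -/
def AbsSummable (r : ℝ) (f : PowerSeries ℝ) : Prop :=
  Summable fun n => |PowerSeries.coeff n f| * r ^ n

theorem Dominated.absSummable {m : ℕ} (hm : 0 < m) {f : PowerSeries ℝ} (hf : Dominated m f) :
    AbsSummable (1 / (4 * m)) f := by
  obtain ⟨K, hK⟩ := exists_coeff_tailOGF_zero_le hm
  have h : Summable fun n => |PowerSeries.coeff n f * (1 / (4 * m)) ^ n| := by
    refine summable_of_abs_mul_le (K := K) fun n => (hK n).trans' ?_
    rw [abs_mul, abs_of_nonneg (by positivity : (0 : ℝ) ≤ (1 / (4 * m)) ^ n)]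
    gcongr
    exact hf n
  refine h.congr fun n => ?_
  rw [abs_mul, abs_of_nonneg (by positivity : (0 : ℝ) ≤ (1 / (4 * m)) ^ n)]

section Evaluation

variable {r : ℝ} {f g : PowerSeries ℝ} {z : ℂ}

theorem AbsSummable.summable_norm (hf : AbsSummable r f) (hz : ‖z‖ ≤ r) :
    Summable fun n => ‖((PowerSeries.coeff n f : ℝ) : ℂ) * z ^ n‖ := by
  refine Summable.of_nonneg_of_le (fun _ => norm_nonneg _) (fun n => ?_) hf
  rw [norm_mul, norm_pow, Complex.norm_real, Real.norm_eq_abs]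
  gcongr

theorem AbsSummable.summable (hf : AbsSummable r f) (hz : ‖z‖ ≤ r) :
    Summable fun n => ((PowerSeries.coeff n f : ℝ) : ℂ) * z ^ n :=
  (hf.summable_norm hz).of_norm

theorem absSummable_one : AbsSummable r 1 :=
  summable_of_ne_finset_zero (s := {0}) fun n hn => by
    simp [PowerSeries.coeff_one, show n ≠ 0 by simpa using hn]

theorem AbsSummable.add (hr : 0 ≤ r) (hf : AbsSummable r f) (hg : AbsSummable r g) :
    AbsSummable r (f + g) := by
  refine Summable.of_nonneg_of_le (fun _ => by positivity) (fun n => ?_) (Summable.add hf hg)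
  rw [map_add, ← add_mul]
  gcongr
  exact abs_add_le _ _

theorem AbsSummable.sub (hr : 0 ≤ r) (hf : AbsSummable r f) (hg : AbsSummable r g) :
    AbsSummable r (f - g) := by
  refine Summable.of_nonneg_of_le (fun _ => by positivity) (fun n => ?_) (Summable.add hf hg)
  rw [map_sub, ← add_mul]
  gcongr
  exact abs_sub _ _

theorem sumAtComplex_add (hf : AbsSummable r f) (hg : AbsSummable r g) (hz : ‖z‖ ≤ r) :
    sumAtComplex (f + g) z = sumAtComplex f z + sumAtComplex g z := by
  rw [sumAtComplex, sumAtComplex, sumAtComplex, ← (hf.summable hz).tsum_add (hg.summable hz)]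
  exact tsum_congr fun n => by rw [map_add]; push_cast; ring

theorem sumAtComplex_sub (hf : AbsSummable r f) (hg : AbsSummable r g) (hz : ‖z‖ ≤ r) :
    sumAtComplex (f - g) z = sumAtComplex f z - sumAtComplex g z := by
  rw [sumAtComplex, sumAtComplex, sumAtComplex, ← (hf.summable hz).tsum_sub (hg.summable hz)]
  exact tsum_congr fun n => by rw [map_sub]; push_cast; ring

theorem sumAtComplex_mul (hf : AbsSummable r f) (hg : AbsSummable r g) (hz : ‖z‖ ≤ r) :
    sumAtComplex (f * g) z = sumAtComplex f z * sumAtComplex g z := by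
  rw [sumAtComplex, sumAtComplex, sumAtComplex,
    tsum_mul_tsum_eq_tsum_sum_antidiagonal_of_summable_norm (hf.summable_norm hz)
      (hg.summable_norm hz)]
  refine tsum_congr fun n => ?_
  rw [PowerSeries.coeff_mul]
  push_cast
  rw [sum_mul]
  refine sum_congr rfl fun q hq => ?_
  rw [← HasAntidiagonal.mem_antidiagonal.1 hq]
  ring

theorem sumAtComplex_one : sumAtComplex 1 z = 1 := by
  rw [sumAtComplex, tsum_eq_single 0]
  · simp
  · intro n hn
    simp [PowerSeries.coeff_one, hn]

theorem sumAtComplex_X : sumAtComplex PowerSeries.X z = z := by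
  rw [sumAtComplex, tsum_eq_single 1]
  · simp
  · intro n hn
    simp [PowerSeries.coeff_X, hn]

theorem sumAtComplex_ofReal (f : PowerSeries ℝ) (x : ℝ) :
    sumAtComplex f x = (sumAt f x : ℂ) := by
  rw [sumAtComplex, sumAt, Complex.ofReal_tsum]
  push_cast
  rfl

variable {x : ℝ}

theorem AbsSummable.summable_real (hf : AbsSummable r f) (hx : |x| ≤ r) :
    Summable fun n => PowerSeries.coeff n f * x ^ n := by
  have h := hf.summable (z := (x : ℂ)) (by simpa using hx)
  exact_mod_cast h

theorem sumAt_sub (hf : AbsSummable r f) (hg : AbsSummable r g) (hx : |x| ≤ r) :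
    sumAt (f - g) x = sumAt f x - sumAt g x := by
  have := sumAtComplex_sub hf hg (z := (x : ℂ)) (by simpa using hx)
  simp only [sumAtComplex_ofReal] at this
  exact_mod_cast this

theorem sumAt_add (hf : AbsSummable r f) (hg : AbsSummable r g) (hx : |x| ≤ r) :
    sumAt (f + g) x = sumAt f x + sumAt g x := by
  have := sumAtComplex_add hf hg (z := (x : ℂ)) (by simpa using hx)
  simp only [sumAtComplex_ofReal] at this
  exact_mod_cast this

theorem sumAt_mul (hf : AbsSummable r f) (hg : AbsSummable r g) (hx : |x| ≤ r) :
    sumAt (f * g) x = sumAt f x * sumAt g x := by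
  have := sumAtComplex_mul hf hg (z := (x : ℂ)) (by simpa using hx)
  simp only [sumAtComplex_ofReal] at this
  exact_mod_cast this

theorem sumAt_one : sumAt 1 x = 1 := by
  have := sumAtComplex_one (z := (x : ℂ))
  rw [sumAtComplex_ofReal] at this
  exact_mod_cast this

theorem norm_sumAtComplex_le (hg : AbsSummable r g)
    (h : ∀ n, |PowerSeries.coeff n f| ≤ PowerSeries.coeff n g) (hz : ‖z‖ ≤ r) :
    ‖sumAtComplex f z‖ ≤ sumAt g r := by
  have hr : 0 ≤ r := (norm_nonneg z).trans hz
  have hg' : Summable fun n => PowerSeries.coeff n g * r ^ n :=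
    hg.summable_real (abs_of_nonneg hr).le
  refine tsum_of_norm_bounded hg'.hasSum fun n => ?_
  rw [norm_mul, norm_pow, Complex.norm_real, Real.norm_eq_abs]
  gcongr
  · exact (abs_nonneg _).trans (h n)
  · exact h n

theorem abs_sumAt_le (hg : AbsSummable r g)
    (h : ∀ n, |PowerSeries.coeff n f| ≤ PowerSeries.coeff n g) (hx : |x| ≤ r) :
    |sumAt f x| ≤ sumAt g r := by
  have := norm_sumAtComplex_le hg h (z := (x : ℂ)) (by simpa using hx)
  rwa [sumAtComplex_ofReal, Complex.norm_real, Real.norm_eq_abs] at this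

end Evaluation

/-! ### Coefficientwise majorants. -/

section Majorants

variable {f g F G : PowerSeries ℝ}

theorem abs_coeff_mul_le (hf : ∀ n, |PowerSeries.coeff n f| ≤ PowerSeries.coeff n F)
    (hg : ∀ n, |PowerSeries.coeff n g| ≤ PowerSeries.coeff n G) (n : ℕ) :
    |PowerSeries.coeff n (f * g)| ≤ PowerSeries.coeff n (F * G) := by
  rw [PowerSeries.coeff_mul, PowerSeries.coeff_mul]
  refine abs_sum_le_sum_abs _ _ |>.trans (sum_le_sum fun q _ => ?_)
  rw [abs_mul]
  exact mul_le_mul (hf _) (hg _) (abs_nonneg _) ((abs_nonneg _).trans (hf _))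

/-- The relation 1/(1 - h) = 1 + h/(1 - h), with h of zero constant term, computes each coefficient
from earlier ones by sums and products, which respect majorants. -/
theorem abs_coeff_inv_one_sub_le (hf : ∀ n, |PowerSeries.coeff n f| ≤ PowerSeries.coeff n F)
    (hF : PowerSeries.constantCoeff F = 0) (n : ℕ) :
    |PowerSeries.coeff n (1 - f)⁻¹| ≤ PowerSeries.coeff n (1 - F)⁻¹ := by
  have hf₀ : PowerSeries.constantCoeff f = 0 := by
    have := hf 0
    rw [PowerSeries.coeff_zero_eq_constantCoeff_apply, PowerSeries.coeff_zero_eq_constantCoeff_apply,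
      hF] at this
    simpa using this
  have inv_eq {h : PowerSeries ℝ} (h₀ : PowerSeries.constantCoeff h = 0) :
      (1 - h)⁻¹ = 1 + h * (1 - h)⁻¹ := by
    have := PowerSeries.mul_inv_cancel (1 - h) (by simp [h₀])
    linear_combination this
  induction n using Nat.strong_induction_on with
  | _ n ih =>
    rw [inv_eq hf₀, inv_eq hF, map_add, map_add, PowerSeries.coeff_mul, PowerSeries.coeff_mul]
    refine (abs_add_le _ _).trans (add_le_add ?_ ?_)
    · rw [PowerSeries.coeff_one]
      split_ifs <;> simp
    · refine abs_sum_le_sum_abs _ _ |>.trans (sum_le_sum fun q hq => ?_)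
      have hq' := HasAntidiagonal.mem_antidiagonal.1 hq
      rcases q with ⟨i, j⟩
      simp only at hq' ⊢
      rw [abs_mul]
      rcases Nat.eq_zero_or_pos i with rfl | hi
      · simp [hf₀, hF]
      · exact mul_le_mul (hf _) (ih j (by omega)) (abs_nonneg _) ((abs_nonneg _).trans (hf _))

end Majorants

/-- From T_0 (1 - T_0) = mx one gets T_0 = mx/(1 - T_0). Hence 1/(1 - T_0) again has coefficients of
order (4m)ⁿ n^(-3/2), and can serve as a majorant. -/
theorem natCast_mul_coeff_inv_one_sub_tailOGF {m : ℕ} (n : ℕ) :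
    (m : ℝ) * PowerSeries.coeff n (1 - tailOGF m 0)⁻¹ =
      PowerSeries.coeff (n + 1) (tailOGF m 0) := by
  have h := PowerSeries.mul_inv_cancel (1 - tailOGF m 0) (by simp [constantCoeff_tailOGF])
  have h' : tailOGF m 0 = PowerSeries.X * (PowerSeries.C (m : ℝ) * (1 - tailOGF m 0)⁻¹) := by
    have hm : (m : PowerSeries ℝ) = PowerSeries.C (m : ℝ) := by simp
    have := tailOGF_zero_eq (m := m)
    rw [hm] at this
    linear_combination (1 - tailOGF m 0)⁻¹ * this - tailOGF m 0 * h
  conv_rhs => rw [h']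
  rw [PowerSeries.coeff_succ_X_mul, PowerSeries.coeff_C_mul]

/-! ### Transfer of coefficient asymptotics. -/

/-- Coefficient asymptotics `β / (2√π) · (4m)ⁿ · n ^ (-3/2)`. -/
def CoeffAsymptotic (m : ℕ) (f : PowerSeries ℝ) (β : ℝ) : Prop :=
  Tendsto (fun n : ℕ => PowerSeries.coeff n f * (1 / (4 * m : ℝ)) ^ n * (n * √n)) atTop
    (𝓝 (β / (2 * √Real.pi)))

theorem CoeffAsymptotic.sub {m : ℕ} {f g : PowerSeries ℝ} {β γ : ℝ} (hf : CoeffAsymptotic m f β)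
    (hg : CoeffAsymptotic m g γ) : CoeffAsymptotic m (f - g) (β - γ) := by
  have := Tendsto.sub hf hg
  rw [← sub_div] at this
  refine this.congr fun n => ?_
  rw [map_sub]
  ring

/-- The coefficients of `X · f' · h`, where `h` has coefficients of order `(4m)ⁿ n ^ (-3/2)`. -/
theorem CoeffAsymptotic.tendsto_deriv_mul {m : ℕ} {f h : PowerSeries ℝ} {β K : ℝ}
    (hf : CoeffAsymptotic m f β)
    (hh : ∀ n : ℕ, |PowerSeries.coeff n h * (1 / (4 * m : ℝ)) ^ n| * (n * √n) ≤ K) :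
    Tendsto (fun n : ℕ => PowerSeries.coeff n (PowerSeries.X * PowerSeries.derivative ℝ f * h) *
      (1 / (4 * m : ℝ)) ^ n * √n) atTop
      (𝓝 (β * sumAt h (1 / (4 * m)) / (2 * √Real.pi))) := by
  have hf' : Tendsto (fun n : ℕ => PowerSeries.coeff n (PowerSeries.X * PowerSeries.derivative ℝ f)
      * (1 / (4 * m : ℝ)) ^ n * √n) atTop (𝓝 (β / (2 * √Real.pi))) := by
    refine hf.congr fun n => ?_
    rcases n with _ | n
    · simp
    · rw [PowerSeries.coeff_succ_X_mul, PowerSeries.coeff_derivative]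
      push_cast
      ring
  have := tendsto_convolution hf' hh (summable_of_abs_mul_le hh).of_abs
  rw [show β * sumAt h (1 / (4 * m)) / (2 * √Real.pi) = β / (2 * √Real.pi) * sumAt h (1 / (4 * m))
    by ring]
  refine this.congr fun n => ?_
  congr 1
  rw [PowerSeries.coeff_mul, sum_mul]
  refine sum_congr rfl fun q hq => ?_
  rw [← HasAntidiagonal.mem_antidiagonal.1 hq]
  ring

theorem coeff_X_mul_derivative (f : PowerSeries ℝ) (n : ℕ) :
    PowerSeries.coeff n (PowerSeries.X * PowerSeries.derivative ℝ f) =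
      n * PowerSeries.coeff n f := by
  rcases n with _ | n
  · simp
  · rw [PowerSeries.coeff_succ_X_mul, PowerSeries.coeff_derivative]
    push_cast
    ring

theorem Dominated.exists_bound {m : ℕ} (hm : 0 < m) {f : PowerSeries ℝ} (hf : Dominated m f) :
    ∃ K, ∀ n : ℕ, |PowerSeries.coeff n f * (1 / (4 * m : ℝ)) ^ n| * (n * √n) ≤ K := by
  obtain ⟨K, hK⟩ := exists_coeff_tailOGF_zero_le hm
  refine ⟨K, fun n => (hK n).trans' ?_⟩
  rw [abs_mul, abs_of_nonneg (by positivity : (0 : ℝ) ≤ (1 / (4 * m)) ^ n)]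
  gcongr
  exact hf n

/-- Leibniz: x(fg)' = (xg')f + (xf')g, and each summand is a convolution of order n^(-1/2) with
order n^(-3/2). -/
theorem CoeffAsymptotic.mul {m : ℕ} (hm : 0 < m) {f g : PowerSeries ℝ} {β γ : ℝ}
    (hf : CoeffAsymptotic m f β) (hg : CoeffAsymptotic m g γ) (hf' : Dominated m f)
    (hg' : Dominated m g) :
    CoeffAsymptotic m (f * g)
      (sumAt f (1 / (4 * m)) * γ + sumAt g (1 / (4 * m)) * β) := by
  obtain ⟨K, hK⟩ := hf'.exists_bound hm
  obtain ⟨L, hL⟩ := hg'.exists_bound hm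
  have := (hg.tendsto_deriv_mul hK).add (hf.tendsto_deriv_mul hL)
  rw [← add_div, mul_comm γ, mul_comm β] at this
  refine this.congr fun n => ?_
  have h : PowerSeries.coeff n (PowerSeries.X * PowerSeries.derivative ℝ g * f) +
      PowerSeries.coeff n (PowerSeries.X * PowerSeries.derivative ℝ f * g) =
      n * PowerSeries.coeff n (f * g) := by
    rw [← coeff_X_mul_derivative, ← map_add, Derivation.leibniz]
    congr 1
    simp only [smul_eq_mul]
    ring
  rw [← add_mul, ← add_mul, h]
  ring

/-- Coefficient asymptotics pass from `f` to the solution `g` of `g (1 - f + g) = X`. -/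
theorem CoeffAsymptotic.of_quadratic {m : ℕ} (hm : 0 < m) {f g : PowerSeries ℝ} {β : ℝ}
    (hf : CoeffAsymptotic m f β) (hfg : g * (1 - f + g) = PowerSeries.X)
    (hg₀ : ∀ n, 0 ≤ PowerSeries.coeff n g)
    (hgf : ∀ n, PowerSeries.coeff n g ≤ PowerSeries.coeff n f) (hf' : Dominated m f)
    (hne : 1 - sumAt f (1 / (4 * m)) + 2 * sumAt g (1 / (4 * m)) ≠ 0) :
    CoeffAsymptotic m g (sumAt g (1 / (4 * m)) * β /
      (1 - sumAt f (1 / (4 * m)) + 2 * sumAt g (1 / (4 * m)))) := by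
  set r : ℝ := 1 / (4 * m) with hr
  have hmr : (0 : ℝ) < m := by exact_mod_cast hm
  have hr₀ : 0 < r := by positivity
  have hg' : Dominated m g := fun n => by
    rw [abs_of_nonneg (hg₀ n)]
    exact (hgf n).trans ((le_abs_self _).trans (hf' n))
  have hd : Dominated m (f - (g + g)) := fun n => by
    have h₁ := hg₀ n
    have h₂ := hgf n
    have h₃ := (le_abs_self _).trans (hf' n)
    rw [map_sub, map_add, abs_le]
    constructor <;> linarith
  have hT : PowerSeries.constantCoeff (tailOGF m 0) = 0 := constantCoeff_tailOGF m 0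
  have hd₀ : PowerSeries.constantCoeff (f - (g + g)) = 0 := by
    have := hd 0
    rw [PowerSeries.coeff_zero_eq_constantCoeff_apply, PowerSeries.coeff_zero_eq_constantCoeff_apply,
      hT] at this
    exact abs_eq_zero.1 (le_antisymm this (abs_nonneg _))
  -- W is the inverse of the derivative 1 - f + 2g of the quadratic in g. Since 0 ≤ g ≤ f, the
  -- coefficients of f - 2g are bounded by those of T_0, so W is majorized by Z.
  set W := (1 - (f - (g + g)))⁻¹ with hW
  set Z := (1 - tailOGF m 0)⁻¹ with hZ
  have hWmul : (1 - (f - (g + g))) * W = 1 := PowerSeries.mul_inv_cancel _ (by simp [hd₀])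
  have hZmul : (1 - tailOGF m 0) * Z = 1 := PowerSeries.mul_inv_cancel _ (by simp [hT])
  have hWZ : ∀ n, |PowerSeries.coeff n W| ≤ PowerSeries.coeff n Z :=
    abs_coeff_inv_one_sub_le hd hT
  obtain ⟨K, hK⟩ := exists_coeff_tailOGF_zero_le hm
  -- W g is majorized by Z T_0 = Z - 1, whose n-th coefficient for n ≥ 1 is that of T_0 at n + 1
  -- divided by m. The 4 is 1/(m r).
  have hWg (n : ℕ) : |PowerSeries.coeff n (W * g)| * r ^ n * (n * √n) ≤ 4 * K := by
    rcases Nat.eq_zero_or_pos n with rfl | hn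
    · have := hK 0
      simp only [CharP.cast_eq_zero, zero_mul, mul_zero] at this ⊢
      linarith
    · have h₁ : Z * tailOGF m 0 = Z - 1 := by linear_combination -hZmul
      have h₂ : |PowerSeries.coeff n (W * g)| ≤ PowerSeries.coeff (n + 1) (tailOGF m 0) / m := by
        refine (abs_coeff_mul_le hWZ hg' n).trans ?_
        rw [h₁, map_sub, PowerSeries.coeff_one, if_neg hn.ne', sub_zero, le_div_iff₀ hmr, mul_comm,
          natCast_mul_coeff_inv_one_sub_tailOGF]
      have h₃ := hK (n + 1)
      have h₄ : 0 ≤ PowerSeries.coeff (n + 1) (tailOGF m 0) := coeff_tailOGF_nonneg _ _ _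
      calc _ ≤ PowerSeries.coeff (n + 1) (tailOGF m 0) / m * r ^ n *
            ((n + 1 : ℕ) * √(n + 1 : ℕ)) := by
              gcongr <;> omega
        _ = 4 * (PowerSeries.coeff (n + 1) (tailOGF m 0) * r ^ (n + 1) *
            ((n + 1 : ℕ) * √(n + 1 : ℕ))) := by
              rw [pow_succ r, hr]
              field_simp
        _ ≤ 4 * K := by linarith
  have hWg' (n : ℕ) : |PowerSeries.coeff n (W * g) * r ^ n| * (n * √n) ≤ 4 * K := by
    rw [abs_mul, abs_of_nonneg (pow_nonneg hr₀.le n)]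
    exact hWg n
  have hWgs : AbsSummable r (W * g) := (summable_of_abs_mul_le hWg').congr fun n => by
    rw [abs_mul, abs_of_nonneg (pow_nonneg hr₀.le n)]
  have hgs := hg'.absSummable hm
  have hfs := hf'.absSummable hm
  have hrr : |r| ≤ r := (abs_of_nonneg hr₀.le).le
  have hsum : sumAt (W * g) r = sumAt g r / (1 - sumAt f r + 2 * sumAt g r) := by
    have h₁ : (1 - (f - (g + g))) * (W * g) = g := by rw [← mul_assoc, hWmul, one_mul]
    have h₂ := hgs.add hr₀.le hgs
    have h₃ := hfs.sub hr₀.le h₂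
    have h₄ := congrArg (sumAt · r) h₁
    rw [sumAt_mul (absSummable_one.sub hr₀.le h₃) hWgs hrr, sumAt_sub absSummable_one h₃ hrr,
      sumAt_sub hfs h₂ hrr, sumAt_add hgs hgs hrr, sumAt_one] at h₄
    rw [eq_div_iff hne]
    linear_combination h₄
  have main := hf.tendsto_deriv_mul hWg'
  rw [hsum] at main
  -- This term is negligible: its normalized coefficients are O(n^(-3/2)), against the main order
  -- n^(-1/2).
  have hXW : Tendsto (fun n : ℕ => PowerSeries.coeff n (PowerSeries.X * W) * r ^ n * √n) atTop
      (𝓝 0) := by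
    have h₀ : Tendsto (fun n : ℕ => K / m / (n : ℝ)) atTop (𝓝 0) :=
      tendsto_const_div_atTop_nhds_zero_nat _
    refine squeeze_zero_norm' ?_ h₀
    filter_upwards [eventually_gt_atTop 0] with n hn
    have hn' : (0 : ℝ) < n := by exact_mod_cast hn
    obtain ⟨k, rfl⟩ := Nat.exists_eq_succ_of_ne_zero hn.ne'
    have h₁ : m * |PowerSeries.coeff k W| ≤ PowerSeries.coeff (k + 1) (tailOGF m 0) := by
      rw [← natCast_mul_coeff_inv_one_sub_tailOGF]
      gcongr
      exact hWZ k
    have h₂ := hK (k + 1)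
    rw [Real.norm_eq_abs, abs_mul, abs_mul, abs_of_nonneg (Real.sqrt_nonneg _),
      abs_of_nonneg (pow_nonneg hr₀.le _), Nat.succ_eq_add_one, PowerSeries.coeff_succ_X_mul,
      div_div, le_div_iff₀ (by positivity)]
    calc _ = (m * |PowerSeries.coeff k W|) * r ^ (k + 1) * ((k + 1 : ℕ) * √(k + 1 : ℕ)) := by ring
      _ ≤ PowerSeries.coeff (k + 1) (tailOGF m 0) * r ^ (k + 1) *
          ((k + 1 : ℕ) * √(k + 1 : ℕ)) := by gcongr
      _ ≤ K := h₂
  have hsumm := main.add hXW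
  rw [add_zero] at hsumm
  have hval : β * (sumAt g r / (1 - sumAt f r + 2 * sumAt g r)) / (2 * √Real.pi) =
      sumAt g r * β / (1 - sumAt f r + 2 * sumAt g r) / (2 * √Real.pi) := by ring
  rw [hval] at hsumm
  refine hsumm.congr fun n => ?_
  -- Differentiating the quadratic equation gives g'(1 - f + 2g) = 1 + f'g; multiply by x W.
  have hD : PowerSeries.X * PowerSeries.derivative ℝ f * (W * g) + PowerSeries.X * W =
      PowerSeries.X * PowerSeries.derivative ℝ g := by
    have h₁ := congrArg (PowerSeries.derivative ℝ) hfg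
    rw [Derivation.leibniz, map_add, map_sub, PowerSeries.derivative_X] at h₁
    simp only [Derivation.map_one_eq_zero, smul_eq_mul, zero_sub] at h₁
    linear_combination -(PowerSeries.X * W) * h₁ + PowerSeries.X * PowerSeries.derivative ℝ g * hWmul
  rw [← add_mul, ← add_mul, ← map_add, hD, coeff_X_mul_derivative]
  ring

/-! ### Behaviour on the circle: expansion at r and analytic continuation. -/

/-- The expansion `f(x) = f(r) - β √(1 - x/r) + O(1 - x/r)` as `x → r⁻`. -/
def SqrtExpansion (r : ℝ) (f : PowerSeries ℝ) (β : ℝ) : Prop :=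
  (fun x : ℝ => sumAt f x - (sumAt f r - β * √(1 - x / r)))
    =O[𝓝[<] r] (fun x : ℝ => 1 - x / r)

/-- The sum of `f` on the closed disc of radius `r` continues analytically to a neighbourhood
of `w`. -/
def Continues (r : ℝ) (f : PowerSeries ℝ) (w : ℂ) : Prop :=
  ∃ F : ℂ → ℂ, AnalyticAt ℂ F w ∧
    ∀ᶠ z in 𝓝[Metric.closedBall (0 : ℂ) r] w, F z = sumAtComplex f z

section Local

variable {r : ℝ} {f g : PowerSeries ℝ} {β γ : ℝ} {w : ℂ}

theorem eventually_nhdsLT_pos_and_lt (hr : 0 < r) : ∀ᶠ x in 𝓝[<] r, 0 < x ∧ x < r := by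
  filter_upwards [Ioo_mem_nhdsLT hr] with x hx using hx

theorem sq_sqrt_one_sub_div {x : ℝ} (hr : 0 < r) (hx : x < r) :
    √(1 - x / r) ^ 2 = 1 - x / r :=
  Real.sq_sqrt (sub_nonneg.2 ((div_le_one hr).2 hx.le))

theorem tendsto_sqrt_one_sub_div (hr : 0 < r) :
    Tendsto (fun x : ℝ => √(1 - x / r)) (𝓝[<] r) (𝓝 0) := by
  have h : Continuous fun x : ℝ => √(1 - x / r) := by fun_prop
  have := h.tendsto r
  rw [div_self hr.ne', sub_self, Real.sqrt_zero] at this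
  exact this.mono_left nhdsWithin_le_nhds

/-- In terms of s = √(1 - x/r), the estimates below become polynomial in s with error s². -/
theorem isBigO_one_sub_div_iff {u : ℝ → ℝ} (hr : 0 < r) :
    u =O[𝓝[<] r] (fun x : ℝ => 1 - x / r) ↔
      ∃ C, ∀ᶠ x in 𝓝[<] r, |u x| ≤ C * √(1 - x / r) ^ 2 := by
  rw [Asymptotics.isBigO_iff]
  refine exists_congr fun C => eventually_congr ?_
  filter_upwards [self_mem_nhdsWithin] with x hx
  have hx' : x < r := hx
  rw [sq_sqrt_one_sub_div hr hx', Real.norm_eq_abs, Real.norm_eq_abs,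
    abs_of_nonneg (sub_nonneg.2 ((div_le_one hr).2 hx'.le))]

theorem SqrtExpansion.sub (hr : 0 < r) (hf : SqrtExpansion r f β) (hg : SqrtExpansion r g γ)
    (hf' : AbsSummable r f) (hg' : AbsSummable r g) : SqrtExpansion r (f - g) (β - γ) := by
  refine (Asymptotics.IsBigO.sub hf hg).congr' ?_ EventuallyEq.rfl
  filter_upwards [eventually_nhdsLT_pos_and_lt hr] with x hx
  rw [sumAt_sub hf' hg' (by rw [abs_of_pos hx.1]; exact hx.2.le),
    sumAt_sub hf' hg' (abs_of_pos hr).le]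
  ring

theorem SqrtExpansion.mul (hr : 0 < r) (hf : SqrtExpansion r f β) (hg : SqrtExpansion r g γ)
    (hf' : AbsSummable r f) (hg' : AbsSummable r g) (hg₀ : ∀ n, 0 ≤ PowerSeries.coeff n g) :
    SqrtExpansion r (f * g) (sumAt f r * γ + sumAt g r * β) := by
  obtain ⟨C, hC⟩ := (isBigO_one_sub_div_iff hr).1 hf
  obtain ⟨D, hD⟩ := (isBigO_one_sub_div_iff hr).1 hg
  refine (isBigO_one_sub_div_iff hr).2
    ⟨C * sumAt g r + (|sumAt f r| + |β|) * D + |β * γ|, ?_⟩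
  have hs1 := (tendsto_sqrt_one_sub_div hr).eventually (ge_mem_nhds one_pos)
  filter_upwards [hC, hD, hs1, eventually_nhdsLT_pos_and_lt hr] with x h₁ h₂ h₃ hx
  have hxr : |x| ≤ r := by rw [abs_of_pos hx.1]; exact hx.2.le
  have hgx : |sumAt g x| ≤ sumAt g r :=
    abs_sumAt_le hg' (fun n => (abs_of_nonneg (hg₀ n)).le) hxr
  rw [sumAt_mul hf' hg' hxr, sumAt_mul hf' hg' (abs_of_pos hr).le]
  have hs₀ : 0 ≤ √(1 - x / r) := Real.sqrt_nonneg _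
  generalize √(1 - x / r) = s at *
  have hp : |sumAt f r - β * s| ≤ |sumAt f r| + |β| := by
    refine (abs_sub _ _).trans ?_
    rw [abs_mul, abs_of_nonneg hs₀]
    have := mul_le_of_le_one_right (abs_nonneg β) h₃
    linarith
  calc _ = |(sumAt f x - (sumAt f r - β * s)) * sumAt g x +
        (sumAt f r - β * s) * (sumAt g x - (sumAt g r - γ * s)) + β * γ * s ^ 2| := by
        congr 1
        ring
    _ ≤ |sumAt f x - (sumAt f r - β * s)| * |sumAt g x| +
        |sumAt f r - β * s| * |sumAt g x - (sumAt g r - γ * s)| + |β * γ| * s ^ 2 := by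
        refine (abs_add_three _ _ _).trans_eq ?_
        rw [abs_mul, abs_mul, abs_mul (β * γ), abs_of_nonneg (sq_nonneg s)]
    _ ≤ (C * s ^ 2) * sumAt g r + (|sumAt f r| + |β|) * (D * s ^ 2) + |β * γ| * s ^ 2 := by
        have : 0 ≤ C * s ^ 2 := (abs_nonneg _).trans h₁
        gcongr
    _ = _ := by ring

theorem sumAt_nonneg (hf₀ : ∀ n, 0 ≤ PowerSeries.coeff n f) {x : ℝ} (hx : 0 ≤ x) :
    0 ≤ sumAt f x :=
  tsum_nonneg fun n => mul_nonneg (hf₀ n) (pow_nonneg hx n)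

theorem sumAtComplex_quadratic (hr : 0 < r) (hfg : g * (1 - f + g) = PowerSeries.X)
    (hf' : AbsSummable r f) (hg' : AbsSummable r g) {z : ℂ} (hz : ‖z‖ ≤ r) :
    sumAtComplex g z * (1 - sumAtComplex f z + sumAtComplex g z) = z := by
  have h := congrArg (sumAtComplex · z) hfg
  have h₁ := absSummable_one.sub hr.le hf'
  simpa only [sumAtComplex_mul hg' (h₁.add hr.le hg') hz, sumAtComplex_add h₁ hg' hz,
    sumAtComplex_sub absSummable_one hf' hz, sumAtComplex_one, sumAtComplex_X] using h

theorem sumAt_quadratic (hr : 0 < r) (hfg : g * (1 - f + g) = PowerSeries.X)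
    (hf' : AbsSummable r f) (hg' : AbsSummable r g) {x : ℝ} (hx : |x| ≤ r) :
    sumAt g x * (1 - sumAt f x + sumAt g x) = x := by
  have := sumAtComplex_quadratic hr hfg hf' hg' (z := (x : ℂ)) (by simpa using hx)
  simp only [sumAtComplex_ofReal] at this
  exact_mod_cast this

theorem SqrtExpansion.of_quadratic (hr : 0 < r) (hf : SqrtExpansion r f β)
    (hfg : g * (1 - f + g) = PowerSeries.X) (hf' : AbsSummable r f) (hg' : AbsSummable r g)
    (hf₀ : ∀ n, 0 ≤ PowerSeries.coeff n f) (hg₀ : ∀ n, 0 ≤ PowerSeries.coeff n g)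
    (hfr : sumAt f r ≤ 1 / 2) :
    SqrtExpansion r g (sumAt g r * β / (1 - sumAt f r + 2 * sumAt g r)) := by
  have hr' : |r| ≤ r := (abs_of_pos hr).le
  have hquad := sumAt_quadratic hr hfg hf' hg' hr'
  have ha₀ : 0 ≤ sumAt g r := sumAt_nonneg hg₀ hr.le
  have ha : 0 < sumAt g r := ha₀.lt_of_ne' fun h => by
    rw [h, zero_mul] at hquad
    exact hr.ne hquad
  set a := sumAt g r with ha_def
  set α := sumAt f r with hα_def
  -- This b makes the coefficient of s vanish when a - b s and α - β s are substituted for g and f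
  -- in the quadratic equation.
  set b := a * β / (1 - α + 2 * a) with hb_def
  have hb : b * (1 - α + 2 * a) = a * β := div_mul_cancel₀ _ (by linarith)
  obtain ⟨C, hC⟩ := (isBigO_one_sub_div_iff hr).1 hf
  refine (isBigO_one_sub_div_iff hr).2 ⟨2 * (r + |b * (β - b)| + (a + |b|) * C), ?_⟩
  have hs1 := (tendsto_sqrt_one_sub_div hr).eventually (ge_mem_nhds one_pos)
  have hs2 : ∀ᶠ x in 𝓝[<] r, b * √(1 - x / r) < a :=
    ((tendsto_sqrt_one_sub_div hr).const_mul b).eventually (gt_mem_nhds (by simpa using ha))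
  filter_upwards [hC, hs1, hs2, eventually_nhdsLT_pos_and_lt hr] with x h₁ h₂ h₃ hx
  have hxr : |x| ≤ r := by rw [abs_of_pos hx.1]; exact hx.2.le
  have hq := sumAt_quadratic hr hfg hf' hg' hxr
  have hgx := sumAt_nonneg hg₀ hx.1.le
  have hfx : sumAt f x ≤ 1 / 2 := (le_abs_self _).trans
    ((abs_sumAt_le hf' (fun n => (abs_of_nonneg (hf₀ n)).le) hxr).trans hfr)
  have hs := sq_sqrt_one_sub_div hr hx.2
  have hx' : x = r - r * √(1 - x / r) ^ 2 := by rw [hs]; field_simp; ring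
  have hs₀ : 0 ≤ √(1 - x / r) := Real.sqrt_nonneg _
  rw [← ha_def]
  rw [← hα_def] at h₁
  generalize √(1 - x / r) = s at *
  have hq₁ : |a - b * s| ≤ a + |b| := by
    refine (abs_sub _ _).trans ?_
    rw [abs_mul, abs_of_nonneg hs₀, abs_of_pos ha]
    have := mul_le_of_le_one_right (abs_nonneg b) h₂
    linarith
  -- For fixed F, the difference of G(1 - F + G) and q(1 - F + q) is (G - q)(1 - F + G + q), here
  -- with q = a - b s. The second factor is at least 1/2 near r, so dividing by it costs the factor
  -- 2 in the constant.
  have key : (sumAt g x - (a - b * s)) * (1 - sumAt f x + sumAt g x + (a - b * s)) =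
      -r * s ^ 2 + b * (β - b) * s ^ 2 + (a - b * s) * (sumAt f x - (α - β * s)) := by
    linear_combination hq + hx' - hquad + s * hb
  have hden : 1 / 2 ≤ 1 - sumAt f x + sumAt g x + (a - b * s) := by linarith
  have hR : |(sumAt g x - (a - b * s)) * (1 - sumAt f x + sumAt g x + (a - b * s))| ≤
      r * s ^ 2 + |b * (β - b)| * s ^ 2 + (a + |b|) * (C * s ^ 2) := by
    rw [key]
    refine (abs_add_three _ _ _).trans ?_
    rw [abs_mul, abs_mul (b * (β - b)), abs_mul (a - b * s), abs_neg, abs_of_pos hr,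
      abs_of_nonneg (sq_nonneg s)]
    gcongr
  rw [abs_mul, abs_of_pos (by linarith : 0 < 1 - sumAt f x + sumAt g x + (a - b * s))] at hR
  have := mul_le_mul_of_nonneg_left hden (abs_nonneg (sumAt g x - (a - b * s)))
  linarith

theorem Continues.sub (hf : Continues r f w) (hg : Continues r g w) (hf' : AbsSummable r f)
    (hg' : AbsSummable r g) : Continues r (f - g) w := by
  obtain ⟨F, hF, hF'⟩ := hf
  obtain ⟨G, hG, hG'⟩ := hg
  refine ⟨F - G, hF.sub hG, ?_⟩
  filter_upwards [hF', hG', self_mem_nhdsWithin] with z h₁ h₂ hz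
  rw [sumAtComplex_sub hf' hg' (by simpa using hz), Pi.sub_apply, h₁, h₂]

theorem Continues.mul (hf : Continues r f w) (hg : Continues r g w) (hf' : AbsSummable r f)
    (hg' : AbsSummable r g) : Continues r (f * g) w := by
  obtain ⟨F, hF, hF'⟩ := hf
  obtain ⟨G, hG, hG'⟩ := hg
  refine ⟨F * G, hF.mul hG, ?_⟩
  filter_upwards [hF', hG', self_mem_nhdsWithin] with z h₁ h₂ hz
  rw [sumAtComplex_mul hf' hg' (by simpa using hz), Pi.mul_apply, h₁, h₂]

/-- A square root with nonnegative real part is the principal one off the branch cut. -/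
theorem eq_cpow_of_sq_eq {y d : ℂ} (h : y ^ 2 = d) (hy : 0 ≤ y.re) (hd : d ∈ Complex.slitPlane) :
    d ^ (2⁻¹ : ℂ) = y := by
  rw [← h]
  refine Complex.sq_cpow_two_inv (hy.lt_of_ne fun h₀ => ?_)
  rw [← h, Complex.mem_slitPlane_iff] at hd
  simp only [sq, Complex.mul_re, Complex.mul_im, ← h₀] at hd
  rcases hd with hd | hd
  · nlinarith [sq_nonneg y.im]
  · simp at hd

theorem sq_mem_slitPlane {y : ℂ} (hy : 0 < y.re) : y ^ 2 ∈ Complex.slitPlane := by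
  rw [Complex.mem_slitPlane_iff]
  simp only [sq, Complex.mul_re, Complex.mul_im]
  by_cases h : y.im = 0
  · left
    rw [h]
    nlinarith
  · right
    have := mul_ne_zero hy.ne' h
    intro h'
    apply this
    linarith

theorem analyticAt_sqrt {D : ℂ → ℂ} (hD : AnalyticAt ℂ D w) (hw : D w ∈ Complex.slitPlane) :
    AnalyticAt ℂ (fun z => D z ^ (2⁻¹ : ℂ)) w :=
  hD.cpow analyticAt_const hw

/-- The discriminant is the square of 1 - f + 2g, whose real part is positive on the closed disc, w
included. So it avoids the branch cut, and the principal root selects g among the two solutions. -/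
theorem Continues.of_quadratic (hr : 0 < r) (hf : Continues r f w)
    (hfg : g * (1 - f + g) = PowerSeries.X) (hf' : AbsSummable r f) (hg' : AbsSummable r g)
    (hg₀ : ∀ n, 0 ≤ PowerSeries.coeff n g)
    (hgf : ∀ n, PowerSeries.coeff n g ≤ PowerSeries.coeff n f)
    (hfr : sumAt f r ≤ 1 / 2) (hw : ‖w‖ ≤ r) : Continues r g w := by
  obtain ⟨F, hF, hF'⟩ := hf
  have hbound (n : ℕ) : |PowerSeries.coeff n (f - (g + g))| ≤ PowerSeries.coeff n f := by
    have h₁ := hg₀ n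
    have h₂ := hgf n
    rw [map_sub, map_add, abs_le]
    constructor <;> linarith
  have hre {z : ℂ} (hz : ‖z‖ ≤ r) :
      0 < (1 - sumAtComplex f z + 2 * sumAtComplex g z).re := by
    have h₁ := norm_sumAtComplex_le hf' hbound hz
    rw [sumAtComplex_sub hf' (hg'.add hr.le hg') hz, sumAtComplex_add hg' hg' hz] at h₁
    have h₂ := (Complex.re_le_norm _).trans (h₁.trans hfr)
    simp only [Complex.sub_re, Complex.add_re] at h₂
    simp
    linarith
  have hsq {z : ℂ} (hz : ‖z‖ ≤ r) : (1 - sumAtComplex f z + 2 * sumAtComplex g z) ^ 2 =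
      (1 - sumAtComplex f z) ^ 2 + 4 * z := by
    linear_combination 4 * sumAtComplex_quadratic hr hfg hf' hg' hz
  have hDan : AnalyticAt ℂ (fun z => (1 - F z) ^ 2 + 4 * z) w := by fun_prop
  -- This needs the closed disc in `Continues`: the agreement includes w itself.
  have hFw : F w = sumAtComplex f w := hF'.self_of_nhdsWithin (by simpa using hw)
  have hDw : (1 - F w) ^ 2 + 4 * w ∈ Complex.slitPlane := by
    rw [hFw, ← hsq hw]
    exact sq_mem_slitPlane (hre hw)
  refine ⟨fun z => (((1 - F z) ^ 2 + 4 * z) ^ (2⁻¹ : ℂ) - (1 - F z)) / 2, ?_, ?_⟩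
  · have := analyticAt_sqrt hDan hDw
    fun_prop
  · filter_upwards [hF', self_mem_nhdsWithin] with z h₁ hz
    have hz' : ‖z‖ ≤ r := by simpa using hz
    rw [h₁, eq_cpow_of_sq_eq (hsq hz') (hre hz').le
      (by rw [← hsq hz']; exact sq_mem_slitPlane (hre hz'))]
    ring

/-- An analytic F satisfies F(x) - F(r) = O(r - x). Comparison with the expansion first gives F(r) =
f(r), then β √(1 - x/r) = O(1 - x/r), which forces β = 0. -/
theorem SqrtExpansion.not_continues (hr : 0 < r) (hf : SqrtExpansion r f β) (hβ : β ≠ 0) :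
    ¬ ∃ F : ℂ → ℂ, AnalyticAt ℂ F (r : ℂ) ∧
      ∀ᶠ z in 𝓝[Metric.ball (0 : ℂ) r] (r : ℂ), F z = sumAtComplex f z := by
  rintro ⟨F, hF, hF'⟩
  have hlim : Tendsto (fun x : ℝ => (x : ℂ)) (𝓝[<] r) (𝓝[Metric.ball (0 : ℂ) r] (r : ℂ)) := by
    refine tendsto_nhdsWithin_iff.2
      ⟨(Complex.continuous_ofReal.tendsto r).mono_left nhdsWithin_le_nhds, ?_⟩
    filter_upwards [eventually_nhdsLT_pos_and_lt hr] with x hx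
    simpa [abs_of_pos hx.1] using hx.2
  have h₁ : (fun x : ℝ => F x - F r) =O[𝓝[<] r] (fun x : ℝ => 1 - x / r) := by
    have := hF.differentiableAt.isBigO_sub.comp_tendsto
      (hlim.mono_right nhdsWithin_le_nhds)
    refine this.trans (Asymptotics.IsBigO.of_bound r (Eventually.of_forall fun x => ?_))
    simp only [Function.comp]
    rw [← Complex.ofReal_sub, Complex.norm_real, ← Real.norm_of_nonneg hr.le, ← norm_mul,
      Real.norm_of_nonneg hr.le, ← norm_neg]
    apply le_of_eq
    congr 1
    field_simp
    ring
  have h₂ : (fun x : ℝ => ((sumAt f x - (sumAt f r - β * √(1 - x / r)) : ℝ) : ℂ))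
      =O[𝓝[<] r] (fun x : ℝ => 1 - x / r) := by
    refine (hf.norm_left.congr_left fun x => ?_).of_norm_left
    rw [Complex.norm_real]
  have h₃ : (fun x : ℝ => F r - sumAt f r + β * √(1 - x / r)) =O[𝓝[<] r]
      (fun x : ℝ => 1 - x / r) := by
    refine (h₂.sub h₁).congr' ?_ EventuallyEq.rfl
    filter_upwards [hlim.eventually hF'] with x hx
    rw [hx, sumAtComplex_ofReal]
    push_cast
    ring
  have hs := tendsto_sqrt_one_sub_div hr
  have h₄ : F r - sumAt f r = 0 := by
    have hlim₁ : Tendsto (fun x : ℝ => 1 - x / r) (𝓝[<] r) (𝓝 0) := by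
      have h : Continuous fun x : ℝ => 1 - x / r := by fun_prop
      have := h.tendsto r
      rw [div_self hr.ne', sub_self] at this
      exact this.mono_left nhdsWithin_le_nhds
    have hlim₂ := h₃.trans_tendsto hlim₁
    have hlim₃ : Tendsto (fun x : ℝ => F r - sumAt f r + β * √(1 - x / r)) (𝓝[<] r)
        (𝓝 (F r - sumAt f r + β * (0 : ℝ))) :=
      (((Complex.continuous_ofReal.tendsto 0).comp hs).const_mul (β : ℂ)).const_add _
    simpa using tendsto_nhds_unique hlim₃ hlim₂
  rw [h₄] at h₃
  obtain ⟨C, hC⟩ := h₃.bound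
  have h₅ : ∀ᶠ x in 𝓝[<] r, |β| ≤ C * √(1 - x / r) := by
    filter_upwards [hC, self_mem_nhdsWithin] with x h hx
    have hx' : x < r := hx
    have hpos : 0 < 1 - x / r := sub_pos.2 ((div_lt_one hr).2 hx')
    rw [zero_add, norm_mul, Complex.norm_real, Complex.norm_real, Real.norm_eq_abs, Real.norm_eq_abs,
      Real.norm_eq_abs, abs_of_nonneg (Real.sqrt_nonneg _), abs_of_pos hpos] at h
    have hq := sq_sqrt_one_sub_div hr hx'
    have hp := Real.sqrt_pos.2 hpos
    generalize √(1 - x / r) = s at *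
    rw [← hq, sq, ← mul_assoc] at h
    exact le_of_mul_le_mul_right h hp
  have h₆ : |β| ≤ C * 0 := ge_of_tendsto (hs.const_mul C) h₅
  rw [mul_zero] at h₆
  exact hβ (abs_eq_zero.1 (le_antisymm h₆ (abs_nonneg _)))

end Local

/-! ### Square-root singular series: closure properties and induction along the tails. -/

/-- `f` is dominated by the total generating function, and its only singularity on the circle of
radius `1 / (4m)` is a square-root singularity at `1 / (4m)` with leading coefficient `-β`. -/
structure SqrtSingular (m : ℕ) (f : PowerSeries ℝ) (β : ℝ) : Prop where
  nonneg : ∀ n, 0 ≤ PowerSeries.coeff n f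
  dominated : Dominated m f
  expansion : SqrtExpansion (1 / (4 * m)) f β
  coeff : CoeffAsymptotic m f β
  continues : ∀ w : ℂ, ‖w‖ = 1 / (4 * m) → w ≠ ((1 / (4 * m) : ℝ) : ℂ) →
    Continues (1 / (4 * m)) f w

theorem dominated_tailOGF (m k : ℕ) : Dominated m (tailOGF m k) := fun n => by
  rw [abs_of_nonneg (coeff_tailOGF_nonneg m k n)]
  exact coeff_tailOGF_le k n

theorem sumAtComplex_tailOGF_zero {m : ℕ} (hm : 0 < m) {z : ℂ} (hz : ‖z‖ ≤ 1 / (4 * m)) :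
    (1 - 2 * sumAtComplex (tailOGF m 0) z) ^ 2 = 1 - z / ((1 / (4 * m) : ℝ) : ℂ) := by
  have hr : (0 : ℝ) ≤ 1 / (4 * m) := by positivity
  have hT := (dominated_tailOGF m 0).absSummable hm
  have hm' : (m : ℂ) ≠ 0 := by exact_mod_cast hm.ne'
  have h : tailOGF m 0 * (1 - tailOGF m 0) = PowerSeries.C (m : ℝ) * PowerSeries.X := by
    have hC : (m : PowerSeries ℝ) = PowerSeries.C (m : ℝ) := by simp
    have := tailOGF_zero_eq (m := m)
    rw [hC] at this
    linear_combination this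
  have hCX : sumAtComplex (PowerSeries.C (m : ℝ) * PowerSeries.X) z = m * z := by
    rw [sumAtComplex, tsum_eq_single 1]
    · simp
    · intro n hn
      rw [PowerSeries.coeff_C_mul, PowerSeries.coeff_X, if_neg hn]
      simp
  have h' := congrArg (sumAtComplex · z) h
  simp only [sumAtComplex_mul hT (absSummable_one.sub hr hT) hz, hCX,
    sumAtComplex_sub absSummable_one hT hz, sumAtComplex_one] at h'
  have : z / ((1 / (4 * m) : ℝ) : ℂ) = 4 * (m * z) := by
    push_cast
    field_simp
  rw [this, ← h']
  ring

theorem sumAt_tailOGF_zero {m : ℕ} (hm : 0 < m) {x : ℝ} (hx : |x| ≤ 1 / (4 * m)) :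
    (1 - 2 * sumAt (tailOGF m 0) x) ^ 2 = 1 - x / (1 / (4 * m)) := by
  have := sumAtComplex_tailOGF_zero hm (z := (x : ℂ)) (by simpa using hx)
  rw [sumAtComplex_ofReal] at this
  exact_mod_cast this

theorem sumAt_tailOGF_zero_radius {m : ℕ} (hm : 0 < m) :
    sumAt (tailOGF m 0) (1 / (4 * m)) = 1 / 2 := by
  have hr : (0 : ℝ) < 1 / (4 * m) := by positivity
  have := sumAt_tailOGF_zero hm (abs_of_pos hr).le
  rw [div_self hr.ne', sub_self] at this
  linarith [pow_eq_zero_iff two_ne_zero |>.1 this]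

theorem Dominated.norm_sumAtComplex_le {m : ℕ} (hm : 0 < m) {f : PowerSeries ℝ}
    (hf : Dominated m f) {z : ℂ} (hz : ‖z‖ ≤ 1 / (4 * m)) : ‖sumAtComplex f z‖ ≤ 1 / 2 :=
  (Godel.norm_sumAtComplex_le ((dominated_tailOGF m 0).absSummable hm) hf hz).trans_eq
    (sumAt_tailOGF_zero_radius hm)

theorem Dominated.sumAt_le {m : ℕ} (hm : 0 < m) {f : PowerSeries ℝ}
    (hf : Dominated m f) {x : ℝ} (hx : |x| ≤ 1 / (4 * m)) : sumAt f x ≤ 1 / 2 := by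
  have := hf.norm_sumAtComplex_le hm (z := (x : ℂ)) (by simpa using hx)
  rw [sumAtComplex_ofReal, Complex.norm_real] at this
  exact (le_abs_self _).trans this

theorem sqrtSingular_tailOGF_zero {m : ℕ} (hm : 0 < m) :
    SqrtSingular m (tailOGF m 0) (1 / 2) where
  nonneg := coeff_tailOGF_nonneg m 0
  dominated := dominated_tailOGF m 0
  coeff := tendsto_coeff_tailOGF_zero hm
  expansion := by
    have hr : (0 : ℝ) < 1 / (4 * m) := by positivity
    refine (isBigO_one_sub_div_iff hr).2 ⟨0, ?_⟩
    filter_upwards [eventually_nhdsLT_pos_and_lt hr] with x hx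
    have hx' : |x| ≤ 1 / (4 * m) := by rw [abs_of_pos hx.1]; exact hx.2.le
    have h₁ := (dominated_tailOGF m 0).sumAt_le hm hx'
    rw [← sumAt_tailOGF_zero hm hx', Real.sqrt_sq (by linarith), sumAt_tailOGF_zero_radius hm,
      zero_mul]
    apply le_of_eq
    rw [abs_eq_zero]
    ring
  continues w hw hne := by
    have hr : (0 : ℝ) < 1 / (4 * m) := by positivity
    -- Only weak positivity is available, as 1 - 2T_0 vanishes at r. The branch cut is avoided
    -- because Re(w/r) < 1 for w ≠ r on the circle.
    have hre {z : ℂ} (hz : ‖z‖ ≤ 1 / (4 * m)) :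
        0 ≤ (1 - 2 * sumAtComplex (tailOGF m 0) z).re := by
      have := (Complex.re_le_norm _).trans ((dominated_tailOGF m 0).norm_sumAtComplex_le hm hz)
      simp
      linarith
    have hDan : AnalyticAt ℂ (fun z : ℂ => 1 - z / ((1 / (4 * m) : ℝ) : ℂ)) w := by
      simp only [div_eq_mul_inv _ (((1 / (4 * m) : ℝ) : ℂ))]
      fun_prop
    have hDw : 1 - w / ((1 / (4 * m) : ℝ) : ℂ) ∈ Complex.slitPlane := by
      rw [Complex.mem_slitPlane_iff]
      left
      rw [Complex.sub_re, Complex.one_re, Complex.div_ofReal_re, sub_pos, div_lt_one hr]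
      refine (hw ▸ Complex.re_le_norm w).lt_of_ne fun h => hne ?_
      have h₁ := Complex.sq_norm w
      rw [Complex.normSq_apply, hw, h] at h₁
      have h₂ : w.im = 0 := by
        have : w.im * w.im = 0 := by linarith
        simpa using this
      exact Complex.ext (by rw [h, Complex.ofReal_re]) (by rw [h₂, Complex.ofReal_im])
    refine ⟨fun z => (1 - (1 - z / ((1 / (4 * m) : ℝ) : ℂ)) ^ (2⁻¹ : ℂ)) / 2, ?_, ?_⟩
    · have := analyticAt_sqrt hDan hDw
      fun_prop
    · have hev : ∀ᶠ z in 𝓝 w, 1 - z / ((1 / (4 * m) : ℝ) : ℂ) ∈ Complex.slitPlane :=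
        hDan.continuousAt.eventually (Complex.isOpen_slitPlane.mem_nhds hDw)
      filter_upwards [self_mem_nhdsWithin, nhdsWithin_le_nhds hev] with z hz hz'
      have hz'' : ‖z‖ ≤ 1 / (4 * m) := by simpa using hz
      rw [eq_cpow_of_sq_eq (sumAtComplex_tailOGF_zero hm hz'') (hre hz'') hz']
      ring

theorem SqrtSingular.sub {m : ℕ} (hm : 0 < m) {f g : PowerSeries ℝ} {β γ : ℝ}
    (hf : SqrtSingular m f β) (hg : SqrtSingular m g γ)
    (hgf : ∀ n, PowerSeries.coeff n g ≤ PowerSeries.coeff n f) :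
    SqrtSingular m (f - g) (β - γ) where
  nonneg n := by rw [map_sub, sub_nonneg]; exact hgf n
  dominated n := by
    have h₁ := hg.nonneg n
    have h₂ := hgf n
    have h₃ := (le_abs_self _).trans (hf.dominated n)
    rw [map_sub, abs_of_nonneg (by linarith)]
    linarith
  expansion := hf.expansion.sub (by positivity) hg.expansion (hf.dominated.absSummable hm)
    (hg.dominated.absSummable hm)
  coeff := hf.coeff.sub hg.coeff
  continues w hw hne := (hf.continues w hw hne).sub (hg.continues w hw hne)
    (hf.dominated.absSummable hm) (hg.dominated.absSummable hm)

theorem SqrtSingular.mul {m : ℕ} (hm : 0 < m) {f g : PowerSeries ℝ} {β γ : ℝ}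
    (hf : SqrtSingular m f β) (hg : SqrtSingular m g γ) :
    SqrtSingular m (f * g) (sumAt f (1 / (4 * m)) * γ + sumAt g (1 / (4 * m)) * β) where
  nonneg n := by
    rw [PowerSeries.coeff_mul]
    exact sum_nonneg fun q _ => mul_nonneg (hf.nonneg _) (hg.nonneg _)
  dominated n := by
    refine (abs_coeff_mul_le hf.dominated hg.dominated n).trans ?_
    -- Domination survives products because T_0² is coefficientwise at most mx + T_0² = T_0.
    have hC : (m : PowerSeries ℝ) = PowerSeries.C (m : ℝ) := by simp
    conv_rhs => rw [tailOGF_zero_eq, hC, map_add, sq]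
    rw [le_add_iff_nonneg_left, PowerSeries.coeff_C_mul, PowerSeries.coeff_X]
    split_ifs <;> simp
  expansion := hf.expansion.mul (by positivity) hg.expansion (hf.dominated.absSummable hm)
    (hg.dominated.absSummable hm) hg.nonneg
  coeff := hf.coeff.mul hm hg.coeff hf.dominated hg.dominated
  continues w hw hne := (hf.continues w hw hne).mul (hg.continues w hw hne)
    (hf.dominated.absSummable hm) (hg.dominated.absSummable hm)

theorem sumAt_pos_of_quadratic {r : ℝ} (hr : 0 < r) {f g : PowerSeries ℝ}
    (hfg : g * (1 - f + g) = PowerSeries.X) (hf' : AbsSummable r f) (hg' : AbsSummable r g)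
    (hg₀ : ∀ n, 0 ≤ PowerSeries.coeff n g) : 0 < sumAt g r := by
  have hquad := sumAt_quadratic hr hfg hf' hg' (abs_of_pos hr).le
  refine (sumAt_nonneg hg₀ hr.le).lt_of_ne' fun h => ?_
  rw [h, zero_mul] at hquad
  exact hr.ne hquad

theorem SqrtSingular.of_quadratic {m : ℕ} (hm : 0 < m) {f g : PowerSeries ℝ} {β : ℝ}
    (hf : SqrtSingular m f β) (hfg : g * (1 - f + g) = PowerSeries.X)
    (hg₀ : ∀ n, 0 ≤ PowerSeries.coeff n g)
    (hgf : ∀ n, PowerSeries.coeff n g ≤ PowerSeries.coeff n f) :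
    SqrtSingular m g (sumAt g (1 / (4 * m)) * β /
      (1 - sumAt f (1 / (4 * m)) + 2 * sumAt g (1 / (4 * m)))) := by
  have hr : (0 : ℝ) < 1 / (4 * m) := by positivity
  have hg' : Dominated m g := fun n => by
    rw [abs_of_nonneg (hg₀ n)]
    exact (hgf n).trans ((le_abs_self _).trans (hf.dominated n))
  have hfs := hf.dominated.absSummable hm
  have hgs := hg'.absSummable hm
  have hfr := hf.dominated.sumAt_le hm (abs_of_pos hr).le
  have ha := sumAt_pos_of_quadratic hr hfg hfs hgs hg₀
  exact
    { nonneg := hg₀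
      dominated := hg'
      expansion := hf.expansion.of_quadratic hr hfg hfs hgs hf.nonneg hg₀ hfr
      coeff := hf.coeff.of_quadratic hm hfg hg₀ hgf hf.dominated (by linarith)
      continues := fun w hw hne => (hf.continues w hw hne).of_quadratic hr hfg hfs hgs hg₀ hgf hfr
        hw.le }

theorem coeff_levelOGF_le {m : ℕ} (k : Fin m) (n : ℕ) :
    PowerSeries.coeff n (levelOGF m k) ≤ PowerSeries.coeff n (tailOGF m k) := by
  rw [tailOGF_eq_add, map_add]
  exact le_add_of_nonneg_right (coeff_tailOGF_nonneg _ _ _)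

theorem levelOGF_quadratic {m : ℕ} (k : Fin m) (hk : k.val + 1 < m) :
    levelOGF m k * (1 - tailOGF m k + levelOGF m k) = PowerSeries.X := by
  rw [tailOGF_eq_add]
  linear_combination levelOGF_eq_of_lt k hk

/-- The single variable with value v_k already contributes x. This covers the top level, where the
quadratic equation is not available. -/
theorem sumAt_levelOGF_pos {m : ℕ} (k : Fin m) : 0 < sumAt (levelOGF m k) (1 / (4 * m)) := by
  have hm := k.pos
  have hr : (0 : ℝ) < 1 / (4 * m) := by positivity
  have hd : Dominated m (levelOGF m k) := fun n => by
    rw [abs_of_nonneg (coeff_levelOGF_nonneg k n)]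
    exact (coeff_levelOGF_le k n).trans (coeff_tailOGF_le k n)
  have hc : (1 : ℝ) ≤ PowerSeries.coeff 1 (levelOGF m k) := by
    rw [levelOGF_eq_sum, map_add, PowerSeries.coeff_one_X, map_sum]
    refine le_add_of_nonneg_right (sum_nonneg fun q _ => ?_)
    rw [PowerSeries.coeff_mul]
    exact sum_nonneg fun _ _ => mul_nonneg (coeff_levelOGF_nonneg _ _) (coeff_levelOGF_nonneg _ _)
  refine ((hd.absSummable hm).summable_real (abs_of_pos hr).le).tsum_pos
    (fun n => mul_nonneg (coeff_levelOGF_nonneg k n) (pow_nonneg hr.le n)) 1 ?_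
  have : 0 < PowerSeries.coeff 1 (levelOGF m k) := one_pos.trans_le hc
  positivity

theorem exists_sqrtSingular_tailOGF {m : ℕ} (k : ℕ) (hk : k < m) :
    ∃ β, 0 < β ∧ SqrtSingular m (tailOGF m k) β := by
  induction k with
  | zero => exact ⟨1 / 2, by norm_num, sqrtSingular_tailOGF_zero hk⟩
  | succ k ih =>
    obtain ⟨β, hβ, h⟩ := ih (by omega)
    have hm : 0 < m := by omega
    have hr : (0 : ℝ) < 1 / (4 * m) := by positivity
    let i : Fin m := ⟨k, by omega⟩
    have hg := h.of_quadratic hm (levelOGF_quadratic i hk) (coeff_levelOGF_nonneg i)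
      (coeff_levelOGF_le i)
    have hsub := h.sub hm hg (coeff_levelOGF_le i)
    have heq : tailOGF m k - levelOGF m i = tailOGF m (k + 1) := by
      rw [sub_eq_iff_eq_add']
      exact tailOGF_eq_add i
    rw [heq] at hsub
    refine ⟨_, ?_, hsub⟩
    have ha := sumAt_levelOGF_pos i
    have hf := h.dominated.sumAt_le hm (abs_of_pos hr).le
    -- With α = T_k(r) and a = G_k(r), the new coefficient is β(1 - α + a)/(1 - α + 2a), positive
    -- since α ≤ 1/2.
    rw [sub_pos, div_lt_iff₀ (by linarith)]
    nlinarith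

theorem exists_sqrtSingular_levelOGF {m : ℕ} (k : Fin m) :
    ∃ β, 0 < β ∧ SqrtSingular m (levelOGF m k) β := by
  obtain ⟨β, hβ, h⟩ := exists_sqrtSingular_tailOGF k.val k.isLt
  have hm := k.pos
  have hr : (0 : ℝ) < 1 / (4 * m) := by positivity
  rcases (show k.val + 1 ≤ m from k.isLt).lt_or_eq with hk | hk
  · have hg := h.of_quadratic hm (levelOGF_quadratic k hk) (coeff_levelOGF_nonneg k)
      (coeff_levelOGF_le k)
    have ha := sumAt_levelOGF_pos k
    have hf := h.dominated.sumAt_le hm (abs_of_pos hr).le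
    exact ⟨_, div_pos (mul_pos ha hβ) (by linarith), hg⟩
  -- The top level is not obtained from the quadratic equation; it is the last tail.
  · have : tailOGF m k = levelOGF m k := by rw [tailOGF_eq_add, hk, tailOGF_self, add_zero]
    exact ⟨β, hβ, this ▸ h⟩

theorem CoeffAsymptotic.isEquivalent {m : ℕ} (hm : 0 < m) {f : PowerSeries ℝ} {β : ℝ}
    (hf : CoeffAsymptotic m f β) (hβ : β ≠ 0) :
    Asymptotics.IsEquivalent atTop (fun n : ℕ => PowerSeries.coeff n f)
      (fun n : ℕ => β / (2 * √Real.pi) * (4 * (m : ℝ)) ^ n * (n : ℝ) ^ (-(3 / 2) : ℝ)) := by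
  have hπ : √Real.pi ≠ 0 := by positivity
  have hm' : (m : ℝ) ≠ 0 := by exact_mod_cast hm.ne'
  have hc : β / (2 * √Real.pi) ≠ 0 := by positivity
  refine Asymptotics.isEquivalent_of_tendsto_one ?_
  have := Tendsto.div_const hf (β / (2 * √Real.pi))
  rw [div_self hc] at this
  refine this.congr' ?_
  filter_upwards [eventually_gt_atTop 0] with n hn
  have hn' : (0 : ℝ) < n := by exact_mod_cast hn
  have h₁ : (n : ℝ) ^ (-(3 / 2) : ℝ) = (n * √n)⁻¹ := by
    rw [Real.rpow_neg hn'.le, show (3 / 2 : ℝ) = 1 + 1 / 2 by norm_num, Real.rpow_add hn',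
      Real.rpow_one, Real.sqrt_eq_rpow]
  have hs : √(n : ℝ) ≠ 0 := by positivity
  rw [Pi.div_apply, h₁, div_pow, one_pow]
  field_simp

theorem SqrtSingular.isDominantSingularity {m : ℕ} (hm : 0 < m) {f : PowerSeries ℝ} {β : ℝ}
    (hf : SqrtSingular m f β) (hβ : β ≠ 0) : IsDominantSingularity f (1 / (4 * m)) := by
  have hr : (0 : ℝ) < 1 / (4 * m) := by positivity
  refine ⟨hr, fun z hz => (hf.dominated.absSummable hm).summable hz.le, fun w hw => ⟨?_, ?_⟩⟩
  · rintro h rfl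
    exact hf.expansion.not_continues hr hβ h
  · intro hne
    obtain ⟨F, hF, hF'⟩ := hf.continues w hw hne
    exact ⟨F, hF, hF'.filter_mono (nhdsWithin_mono w Metric.ball_subset_closedBall)⟩

end Godel

theorem mainTheorem8 (m : ℕ) (hm : 2 ≤ m) (r : ℝ) (hr : r = 1 / (4 * (m : ℝ))) :
    ∃ a b : Fin m → ℝ,
      (∀ k : Fin m,
        b k ≠ 0 ∧
        (∀ x : ℝ, |x| < r →
          Summable fun n => PowerSeries.coeff n (Godel.levelOGF m k) * x ^ n) ∧
        (fun x : ℝ => Godel.sumAt (Godel.levelOGF m k) x - (a k - b k * √(1 - x / r)))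
          =O[nhdsWithin r (Set.Iio r)] (fun x : ℝ => 1 - x / r) ∧
        Asymptotics.IsEquivalent Filter.atTop
          (fun n : ℕ => (Godel.levelCount m k n : ℝ))
          (fun n : ℕ => b k / (2 * √Real.pi) * (4 * (m : ℝ)) ^ n * (n : ℝ) ^ (-(3 / 2) : ℝ))) ∧
      ∀ i j : Fin m,
        Godel.pairOGF m i j = Godel.levelOGF m i * Godel.levelOGF m j ∧
        a i * b j + a j * b i ≠ 0 ∧
        (∃ A : ℝ,
          (fun x : ℝ => Godel.sumAt (Godel.pairOGF m i j) x
              - (A - (a i * b j + a j * b i) * √(1 - x / r)))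
            =O[nhdsWithin r (Set.Iio r)] (fun x : ℝ => 1 - x / r)) ∧
        Asymptotics.IsEquivalent Filter.atTop
          (fun n : ℕ => (Godel.pairCount m i j n : ℝ))
          (fun n : ℕ => (a i * b j + a j * b i) / (2 * √Real.pi) * (4 * (m : ℝ)) ^ n
            * (n : ℝ) ^ (-(3 / 2) : ℝ)) ∧
        Godel.IsDominantSingularity (Godel.pairOGF m i j) r := by
  subst hr
  have hm₀ : 0 < m := by omega
  have hr : (0 : ℝ) < 1 / (4 * m) := by positivity
  choose b hb h using fun k : Fin m => Godel.exists_sqrtSingular_levelOGF k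
  have ha := fun k : Fin m => Godel.sumAt_levelOGF_pos k
  refine ⟨fun k => Godel.sumAt (Godel.levelOGF m k) (1 / (4 * m)), b, fun k => ⟨(hb k).ne', ?_,
    (h k).expansion, ?_⟩, fun i j => ?_⟩
  · exact fun x hx => ((h k).dominated.absSummable hm₀).summable_real hx.le
  · simpa only [Godel.levelOGF, PowerSeries.coeff_mk] using
      (h k).coeff.isEquivalent hm₀ (hb k).ne'
  · have hN := (h i).mul hm₀ (h j)
    have hB : 0 < Godel.sumAt (Godel.levelOGF m i) (1 / (4 * m)) * b j +
        Godel.sumAt (Godel.levelOGF m j) (1 / (4 * m)) * b i :=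
      add_pos (mul_pos (ha i) (hb j)) (mul_pos (ha j) (hb i))
    rw [← Godel.pairOGF_eq_mul] at hN
    refine ⟨Godel.pairOGF_eq_mul i j, hB.ne', ⟨_, hN.expansion⟩, ?_,
      hN.isDominantSingularity hm₀ hB.ne'⟩
    simpa only [Godel.pairOGF, PowerSeries.coeff_mk] using hN.coeff.isEquivalent hm₀ hB.ne'
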